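/- Let $(\mathcal{C},\mathbb{E},\mathfrak{s})$ be a small extriangulated category (in the sense of Nakaoka and Palu) with enough $\mathbb{E}$-projectives and enough $\mathbb{E}$-injectives. Put $\mathbb{E}^{k+1}(A,B):=\mathbb{E}(A,\Sigma^{k}B)$ for $k\ge 0$, where $B\to I\to\Sigma B$ is a conflation with $I$ $\mathbb{E}$-injective. For a full subcategory $\mathcal{X}\subseteq\mathcal{C}$ let $\mathcal{X}_m^{\vee}$ (resp. $\mathcal{X}_m^{\wedge}$) be the class of all objects that have a finite $\mathcal{X}$-coresolution (resp. $\mathcal{X}$-resolution) of length at most $m$, composed of conflations. Let $n\ge 0$ and let $\mathcal{X}$ be an $(n+2)$-cluster tilting subcategory of $\mathcal{C}$, that is: * for each $C\in\mathcal{C}$ there are conflations $K\to X\xrightarrow{g}C$ and $C\xrightarrow{f}X'\to L$ with $X,X'\in\mathcal{X}$, where $g$ is an $\mathcal{X}$-precover and $f$ is an $\mathcal{X}$-preenvelope; * $\mathcal{X}=\{M:\mathbb{E}^{k}(\mathcal{X},M)=0 \text{ for } 1\le k\le n+1\}=\{M:\mathbb{E}^{k}(M,\mathcal{X})=0\text{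 for }1\le k\le n+1\}.$ Let $[\mathcal{X}]$ be the ideal of all morphisms of $\mathcal{C}$ that factor through an object of $\mathcal{X}$, and $\mathcal{D}:=\mathcal{C}/[\mathcal{X}]$. Let $\underline{\mathcal{X}_n^{\vee}}$ be the quotient of $\mathcal{X}_n^{\vee}$ by the ideal of the morphisms $f$ with $\mathbb{E}(f,-)=0$, and $\overline{\mathcal{X}_n^{\wedge}}$ the quotient of $\mathcal{X}_n^{\wedge}$ by the ideal of the morphisms $f$ with $\mathbb{E}(-,f)=0$. Right (left) modules over such a category are the additive contravariant (covariant) functors to abelian groups. Let $\mathcal{R}_{\mathcal{X}}^{n}$ be the full subcategory of the right $\underline{\mathcal{X}_n^{\vee}}$-modules $G$ for which there is an exact sequence $$\underline{\mathcal{X}_n^{\vee}}(-,X_0)\to\underline{\mathcal{X}_n^{\vee}}(-,X_1)\to G\to 0,\qquad X_0\in\mathcal{X},\ X_1\in\mathcal{X}_n^{\vee},$$ and $\mathcal{L}_{\mathcal{X}}^{n}$ the full subcategory of the left $\overline{\mathcal{X}_n^{\wedge}}$-modules $G$ for which there is an exact sequence $$\overline{\mathcal{X}_n^{\wedge}}(X_0,-)\to\overline{\mathcal{X}_n^{\wedge}}(X_1,-)\to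 G\to 0,\qquad X_0\in\mathcal{X},\ X_1\in\mathcal{X}_n^{\wedge}.$$ Both carry the class of those sequences that are short exact as sequences of modules. Then $\mathcal{X}_{n+1}^{\vee}=\mathcal{C}=\mathcal{X}_{n+1}^{\wedge}$. The ideal $[\mathcal{X}]$ is the kernel of the functor $M\mapsto\mathbb{E}(-,M)|_{\mathcal{X}_n^{\vee}}$ from $\mathcal{C}$ to the right $\underline{\mathcal{X}_n^{\vee}}$-modules and also the kernel of the contravariant functor $M\mapsto\mathbb{E}(M,-)|_{\mathcal{X}_n^{\wedge}}$ from $\mathcal{C}$ to the left $\overline{\mathcal{X}_n^{\wedge}}$-modules, so that these induce on $\mathcal{D}$ a covariant functor $\mathbb{F}$ and a contravariant functor $\mathbb{K}$. Let $\varepsilon_{\mathbb{F}}$ (resp. $\varepsilon_{\mathbb{K}}$) be the class of all pairs $A'\xrightarrow{i}A\xrightarrow{p}A''$ in $\mathcal{D}$ such that $0\to\mathbb{F}A'\to\mathbb{F}A\to\mathbb{F}A''\to0$ (resp. $0\to\mathbb{K}A''\to\mathbb{K}A\to\mathbb{K}A'\to0$) is exact. Then: (a) $(\mathcal{D},\varepsilon_{\mathbb{F}})$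 and $(\mathcal{D},\varepsilon_{\mathbb{K}})$ are weakly idempotent complete exact categories, and $\mathcal{D}$ is Krull–Schmidt if $\mathcal{C}$ is. (b) $\mathcal{R}_{\mathcal{X}}^{n}$ and $\mathcal{L}_{\mathcal{X}}^{n}$ are exact categories, $\mathbb{F}:(\mathcal{D},\varepsilon_{\mathbb{F}})\to\mathcal{R}_{\mathcal{X}}^{n}$ is an equivalence of exact categories, and $\mathbb{K}:(\mathcal{D},\varepsilon_{\mathbb{K}})\to\mathcal{L}_{\mathcal{X}}^{n}$ is a duality of exact categories. In particular, there is a duality of categories between $\mathcal{R}_{\mathcal{X}}^{n}$ and $\mathcal{L}_{\mathcal{X}}^{n}$. -/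

import Mathlib

open CategoryTheory CategoryTheory.Limits Opposite

universe v u v' u'

noncomputable section

namespace ClusterQuotient

/-! ## Extriangulated categories -/

section Extriangulated

variable (C : Type u) [Category.{v} C]

/-- A sequence of morphisms `A ⟶ B ⟶ D` with prescribed end terms. -/
structure Seq (A D : C) where
  mid : C
  inf : A ⟶ mid
  defl : mid ⟶ D

/-- Two sequences `A ⟶ B ⟶ D` and `A ⟶ B' ⟶ D` are equivalent if there is an isomorphism
`B ≅ B'` compatible with the identities of `A` and `D`. -/
instance seqSetoid (A D : C) : Setoid (Seq C A D) where
  r S S' := ∃ b : S.mid ≅ S'.mid, S.inf ≫ b.hom = S'.inf ∧ b.hom ≫ S'.defl = S.defl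
  iseqv :=
    { refl := fun S => ⟨Iso.refl _, by simp, by simp⟩
      symm := by
        rintro S S' ⟨b, h₁, h₂⟩
        exact ⟨b.symm, by simp [← h₁], by simp [← h₂]⟩
      trans := by
        rintro S S' S'' ⟨b, h₁, h₂⟩ ⟨b', h₁', h₂'⟩
        exact ⟨b ≪≫ b', by simp [← h₁', ← h₁], by simp [h₂', h₂]⟩ }

/-- Equivalence classes `[A ⟶ B ⟶ D]`. -/
abbrev SeqClass (A D : C) := Quotient (seqSetoid C A D)

/-- The data of a bifunctor `𝔼 : Cᵒᵖ × C → Ab` and of a correspondence `𝔰` that associates to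
each extension an equivalence class of sequences. The axioms are in `Extriangulation`. -/
structure ExtData where
  E : Cᵒᵖ ⥤ C ⥤ AddCommGrpCat.{v}
  s : ∀ ⦃A D : C⦄, ((E.obj (op D)).obj A) → SeqClass C A D

variable {C}

namespace ExtData

variable (T : ExtData C)

/-- The group `𝔼(D, A)`. -/
abbrev Ext (D A : C) : Type v := (T.E.obj (op D)).obj A

/-- `a · δ = 𝔼(D, a)(δ)`. -/
def push {D A A' : C} (a : A ⟶ A') (δ : T.Ext D A) : T.Ext D A' :=
  ((T.E.obj (op D)).map a).hom δ

/-- `δ · c = 𝔼(c, A)(δ)`. -/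
def pull {D D' A : C} (c : D' ⟶ D) (δ : T.Ext D A) : T.Ext D' A :=
  ((T.E.map c.op).app A).hom δ

/-- `A ⟶ B ⟶ D` realizes `δ`, that is, `A ⟶ B ⟶ D` together with `δ` is an `𝔼`-triangle. -/
def Realizes {A B D : C} (x : A ⟶ B) (y : B ⟶ D) (δ : T.Ext D A) : Prop :=
  T.s δ = (⟦⟨B, x, y⟩⟧ : SeqClass C A D)

/-- A conflation is a sequence that realizes some extension. -/
def Conflation {A B D : C} (x : A ⟶ B) (y : B ⟶ D) : Prop :=
  ∃ δ : T.Ext D A, T.Realizes x y δ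

/-- The direct sum `δ ⊕ δ' ∈ 𝔼(D ⊕ D', A ⊕ A')`. -/
def directSum [Preadditive C] [HasBinaryBiproducts C] {A D A' D' : C}
    (δ : T.Ext D A) (δ' : T.Ext D' A') : T.Ext (D ⊞ D') (A ⊞ A') :=
  T.push biprod.inl (T.pull biprod.fst δ) + T.push biprod.inr (T.pull biprod.snd δ')

end ExtData

variable (C) in
/-- The structure of an extriangulated category (Nakaoka–Palu) on an additive category `C`. -/
structure Extriangulation [Preadditive C] [HasZeroObject C] [HasBinaryBiproducts C] extends ExtData C where
  /-- (ET1): `𝔼` is additive in both variables. -/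
  additive_right : ∀ D : C, (E.obj (op D)).Additive
  additive_left : ∀ A : C, (E.flip.obj A).Additive
  /-- (ET2): `𝔰` is a realization. -/
  realization : ∀ ⦃A B D A' B' D' : C⦄ (x : A ⟶ B) (y : B ⟶ D) (x' : A' ⟶ B') (y' : B' ⟶ D')
    (δ : toExtData.Ext D A) (δ' : toExtData.Ext D' A'),
    toExtData.Realizes x y δ → toExtData.Realizes x' y' δ' →
    ∀ (a : A ⟶ A') (c : D ⟶ D'), toExtData.push a δ = toExtData.pull c δ' →
      ∃ b : B ⟶ B', x ≫ b = a ≫ x' ∧ y ≫ c = b ≫ y'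
  /-- (ET2): `𝔰` is additive. -/
  realizes_zero : ∀ A D : C,
    toExtData.Realizes (biprod.inl : A ⟶ A ⊞ D) (biprod.snd : A ⊞ D ⟶ D) 0
  realizes_directSum : ∀ ⦃A B D A' B' D' : C⦄ (x : A ⟶ B) (y : B ⟶ D) (x' : A' ⟶ B')
    (y' : B' ⟶ D') (δ : toExtData.Ext D A) (δ' : toExtData.Ext D' A'),
    toExtData.Realizes x y δ → toExtData.Realizes x' y' δ' →
      toExtData.Realizes (biprod.map x x') (biprod.map y y') (toExtData.directSum δ δ')
  /-- (ET3) -/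
  ET3 : ∀ ⦃A B D A' B' D' : C⦄ (x : A ⟶ B) (y : B ⟶ D) (x' : A' ⟶ B') (y' : B' ⟶ D')
    (δ : toExtData.Ext D A) (δ' : toExtData.Ext D' A'),
    toExtData.Realizes x y δ → toExtData.Realizes x' y' δ' →
    ∀ (a : A ⟶ A') (b : B ⟶ B'), x ≫ b = a ≫ x' →
      ∃ c : D ⟶ D', y ≫ c = b ≫ y' ∧ toExtData.push a δ = toExtData.pull c δ'
  /-- (ET3)ᵒᵖ -/
  ET3op : ∀ ⦃A B D A' B' D' : C⦄ (x : A ⟶ B) (y : B ⟶ D) (x' : A' ⟶ B') (y' : B' ⟶ D')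
    (δ : toExtData.Ext D A) (δ' : toExtData.Ext D' A'),
    toExtData.Realizes x y δ → toExtData.Realizes x' y' δ' →
    ∀ (b : B ⟶ B') (c : D ⟶ D'), y ≫ c = b ≫ y' →
      ∃ a : A ⟶ A', x ≫ b = a ≫ x' ∧ toExtData.push a δ = toExtData.pull c δ'
  /-- (ET4) -/
  ET4 : ∀ ⦃A B D M F : C⦄ (f : A ⟶ B) (f' : B ⟶ D) (g : B ⟶ M) (g' : M ⟶ F)
    (δ : toExtData.Ext D A) (δ' : toExtData.Ext F B),
    toExtData.Realizes f f' δ → toExtData.Realizes g g' δ' →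
      ∃ (N : C) (h' : M ⟶ N) (d : D ⟶ N) (e : N ⟶ F) (δ'' : toExtData.Ext N A),
        f' ≫ d = g ≫ h' ∧ h' ≫ e = g' ∧
        toExtData.Realizes (f ≫ g) h' δ'' ∧
        toExtData.Realizes d e (toExtData.push f' δ') ∧
        toExtData.pull d δ'' = δ ∧
        toExtData.push f δ'' = toExtData.pull e δ'
  /-- (ET4)ᵒᵖ -/
  ET4op : ∀ ⦃D A B F M : C⦄ (f' : D ⟶ A) (f : A ⟶ B) (g' : F ⟶ B) (g : B ⟶ M)
    (δ : toExtData.Ext B D) (δ' : toExtData.Ext M F),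
    toExtData.Realizes f' f δ → toExtData.Realizes g' g δ' →
      ∃ (N : C) (d : D ⟶ N) (e : N ⟶ F) (h' : N ⟶ A) (δ'' : toExtData.Ext M N),
        d ≫ h' = f' ∧ h' ≫ f = e ≫ g' ∧
        toExtData.Realizes h' (f ≫ g) δ'' ∧
        toExtData.Realizes d e (toExtData.pull g' δ) ∧
        toExtData.push e δ'' = δ' ∧
        toExtData.push d δ = toExtData.pull g δ''

/-! ## Projectives, injectives, resolutions, higher extensions, cluster tilting -/

namespace Extriangulation

variable [Preadditive C] [HasZeroObject C] [HasBinaryBiproducts C] (T : Extriangulation C)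

/-- `𝔼`-projective objects. -/
def EProj : ObjectProperty C := fun P =>
  ∀ ⦃A B D : C⦄ (x : A ⟶ B) (y : B ⟶ D), T.Conflation x y →
    ∀ f : P ⟶ D, ∃ g : P ⟶ B, g ≫ y = f

/-- `𝔼`-injective objects. -/
def EInj : ObjectProperty C := fun I =>
  ∀ ⦃A B D : C⦄ (x : A ⟶ B) (y : B ⟶ D), T.Conflation x y →
    ∀ f : A ⟶ I, ∃ g : B ⟶ I, x ≫ g = f

/-- `C` has enough `𝔼`-projectives. -/
def EnoughEProj : Prop :=
  ∀ D : C, ∃ (A P : C) (x : A ⟶ P) (y : P ⟶ D), T.EProj P ∧ T.Conflation x y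

/-- `C` has enough `𝔼`-injectives. -/
def EnoughEInj : Prop :=
  ∀ A : C, ∃ (I D : C) (x : A ⟶ I) (y : I ⟶ D), T.EInj I ∧ T.Conflation x y

/-- `HasResolution X n D`: there is a finite `X`-resolution
`0 ⟶ Xₙ ⟶ ⋯ ⟶ X₀ ⟶ D ⟶ 0` of length `n`, put together from conflations. -/
def HasResolution (X : ObjectProperty C) : ℕ → ObjectProperty C
  | 0 => X.isoClosure
  | n + 1 => fun D => ∃ (K X₀ : C) (x : K ⟶ X₀) (y : X₀ ⟶ D),
      T.Conflation x y ∧ X X₀ ∧ HasResolution X n K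

/-- `HasCoresolution X n D`: there is a finite `X`-coresolution
`0 ⟶ D ⟶ X₀ ⟶ ⋯ ⟶ Xₙ ⟶ 0` of length `n`, put together from conflations. -/
def HasCoresolution (X : ObjectProperty C) : ℕ → ObjectProperty C
  | 0 => X.isoClosure
  | n + 1 => fun D => ∃ (X₀ L : C) (x : D ⟶ X₀) (y : X₀ ⟶ L),
      T.Conflation x y ∧ X X₀ ∧ HasCoresolution X n L

/-- `X_n^∧`: the objects of `X`-resolution dimension at most `n`. -/
def wedge (X : ObjectProperty C) (n : ℕ) : ObjectProperty C :=
  fun D => ∃ m ≤ n, T.HasResolution X m D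

/-- `X_n^∨`: the objects of `X`-coresolution dimension at most `n`. -/
def vee (X : ObjectProperty C) (n : ℕ) : ObjectProperty C :=
  fun D => ∃ m ≤ n, T.HasCoresolution X m D

variable {T} in
/-- A chosen cosyzygy `Σ A`, given by a conflation `A ⟶ I ⟶ Σ A` with `I` injective. -/
def cosyzygy (hI : T.EnoughEInj) (A : C) : C := (hI A).choose_spec.choose

variable {T} in
/-- The higher extension group `𝔼^{k+1}(D, A) = 𝔼(D, Σ^k A)`; in particular `𝔼¹ = 𝔼`. Up to
isomorphism it does not depend on the choice of the cosyzygies. -/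
abbrev higherExt (hI : T.EnoughEInj) (k : ℕ) (D A : C) : Type v :=
  T.Ext D ((cosyzygy hI)^[k] A)

/-- `X` is strongly precovering: each object `D` has an `𝔼`-triangle `K ⟶ X₀ ⟶ D` in which
`X₀ ⟶ D` is an `X`-precover. -/
def StronglyPrecovering (X : ObjectProperty C) : Prop :=
  ∀ D : C, ∃ (K X₀ : C) (x : K ⟶ X₀) (g : X₀ ⟶ D), T.Conflation x g ∧ X X₀ ∧
    ∀ X' : C, X X' → ∀ f : X' ⟶ D, ∃ f' : X' ⟶ X₀, f' ≫ g = f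

/-- `X` is strongly preenveloping: each object `D` has an `𝔼`-triangle `D ⟶ X₀ ⟶ L` in which
`D ⟶ X₀` is an `X`-preenvelope. -/
def StronglyPreenveloping (X : ObjectProperty C) : Prop :=
  ∀ D : C, ∃ (X₀ L : C) (g : D ⟶ X₀) (y : X₀ ⟶ L), T.Conflation g y ∧ X X₀ ∧
    ∀ X' : C, X X' → ∀ f : D ⟶ X', ∃ f' : X₀ ⟶ X', g ≫ f' = f

/-- `X` is `(n+2)`-cluster tilting. The index `k ≤ n` stands for the degree `k + 1`, which runs
through `1, …, n + 1`. -/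
structure IsClusterTilting (hI : T.EnoughEInj) (n : ℕ) (X : ObjectProperty C) : Prop where
  precovering : T.StronglyPrecovering X
  preenveloping : T.StronglyPreenveloping X
  right_orthogonal : ∀ M : C,
    X M ↔ ∀ k ≤ n, ∀ X' : C, X X' → Subsingleton (higherExt hI k X' M)
  left_orthogonal : ∀ M : C,
    X M ↔ ∀ k ≤ n, ∀ X' : C, X X' → Subsingleton (higherExt hI k M X')

end Extriangulation

end Extriangulated

/-! ## Ideals and quotient categories -/

section Ideals

/-- A two-sided ideal of a preadditive category. -/
structure HomIdeal (A : Type u) [Category.{v} A] [Preadditive A] where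
  carrier : ∀ M N : A, AddSubgroup (M ⟶ N)
  precomp : ∀ {L M N : A} (f : L ⟶ M) {g : M ⟶ N}, g ∈ carrier M N → f ≫ g ∈ carrier L N
  postcomp : ∀ {L M N : A} {f : L ⟶ M} (g : M ⟶ N), f ∈ carrier L M → f ≫ g ∈ carrier L N

variable {A : Type u} [Category.{v} A] [Preadditive A]

namespace HomIdeal

variable (I : HomIdeal A)

/-- Two morphisms are identified in `A / I` if their difference lies in `I`. -/
def rel : HomRel A := fun M N f g => f - g ∈ I.carrier M N

instance : Congruence I.rel where
  comp_left f g g' h := by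
    have h' := I.precomp f h
    rwa [Preadditive.comp_sub] at h'
  comp_right g h := by
    have h' := I.postcomp g h
    rwa [Preadditive.sub_comp] at h'
  equivalence :=
    { refl := fun f => by
        change f - f ∈ _
        rw [sub_self]; exact zero_mem _
      symm := fun {f g} h => by
        change g - f ∈ _
        rw [← neg_sub]; exact neg_mem h
      trans := fun {f g k} h h' => by
        change f - k ∈ _
        rw [← sub_add_sub_cancel f g k]; exact add_mem h h' }

/-- The quotient category `A / I`. -/
abbrev Quot : Type u := CategoryTheory.Quotient I.rel

/-- The quotient functor `A ⟶ A / I`. -/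
abbrev proj : A ⥤ I.Quot := CategoryTheory.Quotient.functor I.rel

instance : Preadditive I.Quot :=
  CategoryTheory.Quotient.preadditive I.rel (fun _ _ f₁ f₂ g₁ g₂ h h' => by
    change f₁ + g₁ - (f₂ + g₂) ∈ _
    rw [add_sub_add_comm]; exact add_mem h h')

/-- The functor `A / I ⟶ B` induced by a functor `F : A ⟶ B` that is constant on the classes of
morphisms modulo `I`. -/
abbrev lift {B : Type u'} [Category.{v'} B] (F : A ⥤ B)
    (h : ∀ ⦃M N : A⦄ (f g : M ⟶ N), f - g ∈ I.carrier M N → F.map f = F.map g) :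
    I.Quot ⥤ B :=
  CategoryTheory.Quotient.lift I.rel F (fun _ _ f g hfg => h f g hfg)

/-- The functor `(A / I)ᵒᵖ ⟶ B` induced by a functor `F : Aᵒᵖ ⟶ B` that is constant on the classes
of morphisms modulo `I`. -/
abbrev liftOp {B : Type u'} [Category.{v'} B] (F : Aᵒᵖ ⥤ B)
    (h : ∀ ⦃M N : A⦄ (f g : M ⟶ N), f - g ∈ I.carrier M N → F.map f.op = F.map g.op) :
    I.Quotᵒᵖ ⥤ B :=
  (I.lift F.rightOp (fun _ _ f g hfg => congrArg Quiver.Hom.op (h f g hfg))).leftOp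

end HomIdeal

/-- `X` contains a zero object and the direct sum of any two of its objects. -/
structure ClosedUnderSums [HasBinaryBiproducts A] (X : ObjectProperty A) : Prop where
  zero : ∃ Z, IsZero Z ∧ X Z
  biprod : ∀ M N, X M → X N → X (M ⊞ N)

/-- The ideal `[X]` of all morphisms that factor through an object of `X`. -/
def factorIdeal [HasBinaryBiproducts A] (X : ObjectProperty A) (hX : ClosedUnderSums X) :
    HomIdeal A where
  carrier M N :=
    { carrier := {f | ∃ (Z : A) (_ : X Z) (g : M ⟶ Z) (h : Z ⟶ N), g ≫ h = f}
      zero_mem' := by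
        obtain ⟨Z, _, hZ⟩ := hX.zero
        exact ⟨Z, hZ, 0, 0, by simp⟩
      add_mem' := by
        rintro _ _ ⟨Z, hZ, g, h, rfl⟩ ⟨Z', hZ', g', h', rfl⟩
        exact ⟨Z ⊞ Z', hX.biprod _ _ hZ hZ', biprod.lift g g', biprod.desc h h', by simp⟩
      neg_mem' := by
        rintro _ ⟨Z, hZ, g, h, rfl⟩
        exact ⟨Z, hZ, -g, h, by simp⟩ }
  precomp f _ hf := by
    obtain ⟨Z, hZ, g, h, rfl⟩ := hf
    exact ⟨Z, hZ, f ≫ g, h, by simp⟩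
  postcomp k hf := by
    obtain ⟨Z, hZ, g, h, rfl⟩ := hf
    exact ⟨Z, hZ, g, h ≫ k, by simp⟩

end Ideals

/-! ## Exact categories, weak idempotent completeness, Krull–Schmidt categories -/

section Exact

/-- A class of pairs `(i, p)` of composable morphisms. -/
abbrev PairClass (A : Type u) [Category.{v} A] :=
  ∀ ⦃M N L : A⦄, (M ⟶ N) → (N ⟶ L) → Prop

variable {A : Type u} [Category.{v} A]

/-- Admissible monics of a class of pairs. -/
def AdmMono (ε : PairClass A) {M N : A} (i : M ⟶ N) : Prop := ∃ (L : A) (p : N ⟶ L), ε i p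

/-- Admissible epics of a class of pairs. -/
def AdmEpi (ε : PairClass A) {N L : A} (p : N ⟶ L) : Prop := ∃ (M : A) (i : M ⟶ N), ε i p

/-- `(A, ε)` is an exact category in the sense of Quillen (with the axioms of Bühler's survey);
in particular `A` is an additive category. -/
structure IsExactCategory [Preadditive A] (ε : PairClass A) : Prop where
  additive : HasFiniteBiproducts A
  kernel_cokernel : ∀ ⦃M N L : A⦄ (i : M ⟶ N) (p : N ⟶ L), ε i p → ∃ w : i ≫ p = 0,
    Nonempty (IsLimit (KernelFork.ofι i w)) ∧ Nonempty (IsColimit (CokernelCofork.ofπ p w))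
  iso_closed : ∀ ⦃M N L M' N' L' : A⦄ (i : M ⟶ N) (p : N ⟶ L) (i' : M' ⟶ N') (p' : N' ⟶ L')
    (e₁ : M ≅ M') (e₂ : N ≅ N') (e₃ : L ≅ L'), i ≫ e₂.hom = e₁.hom ≫ i' →
    p ≫ e₃.hom = e₂.hom ≫ p' → ε i p → ε i' p'
  id_admMono : ∀ M : A, AdmMono ε (𝟙 M)
  id_admEpi : ∀ M : A, AdmEpi ε (𝟙 M)
  comp_admMono : ∀ ⦃M N L : A⦄ (i : M ⟶ N) (j : N ⟶ L),
    AdmMono ε i → AdmMono ε j → AdmMono ε (i ≫ j)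
  comp_admEpi : ∀ ⦃M N L : A⦄ (p : M ⟶ N) (q : N ⟶ L),
    AdmEpi ε p → AdmEpi ε q → AdmEpi ε (p ≫ q)
  pushout : ∀ ⦃M N M' : A⦄ (i : M ⟶ N) (f : M ⟶ M'), AdmMono ε i →
    ∃ (N' : A) (f' : N ⟶ N') (i' : M' ⟶ N'), IsPushout i f f' i' ∧ AdmMono ε i'
  pullback : ∀ ⦃N L L' : A⦄ (p : N ⟶ L) (f : L' ⟶ L), AdmEpi ε p →
    ∃ (N' : A) (f' : N' ⟶ N) (p' : N' ⟶ L'), IsPullback f' p' p f ∧ AdmEpi ε p'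

/-- An equivalence of exact categories: an equivalence that preserves and reflects the
distinguished short exact sequences. -/
structure IsExactEquivalence {B : Type u'} [Category.{v'} B] (F : A ⥤ B)
    (ε : PairClass A) (ε' : PairClass B) : Prop where
  isEquivalence : F.IsEquivalence
  map_iff : ∀ ⦃M N L : A⦄ (i : M ⟶ N) (p : N ⟶ L), ε i p ↔ ε' (F.map i) (F.map p)

/-- A duality of exact categories: a contravariant equivalence that preserves and reflects the
distinguished short exact sequences. -/
structure IsExactDuality {B : Type u'} [Category.{v'} B] (K : Aᵒᵖ ⥤ B)
    (ε : PairClass A) (ε' : PairClass B) : Prop where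
  isEquivalence : K.IsEquivalence
  map_iff : ∀ ⦃M N L : A⦄ (i : M ⟶ N) (p : N ⟶ L), ε i p ↔ ε' (K.map p.op) (K.map i.op)

/-- The class `ε_F` of the pairs `(i, p)` for which `0 ⟶ F M ⟶ F N ⟶ F L ⟶ 0` is exact. -/
def inducedClass {B : Type u'} [Category.{v'} B] [Abelian B] (F : A ⥤ B) : PairClass A :=
  fun _ _ _ i p =>
    ∃ w : F.map i ≫ F.map p = 0, (ShortComplex.mk (F.map i) (F.map p) w).ShortExact

/-- The class `ε_K` of the pairs `(i, p)` for which `0 ⟶ K L ⟶ K N ⟶ K M ⟶ 0` is exact, for a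
contravariant functor `K`. -/
def inducedClassOp {B : Type u'} [Category.{v'} B] [Abelian B] (K : Aᵒᵖ ⥤ B) : PairClass A :=
  fun _ _ _ i p =>
    ∃ w : K.map p.op ≫ K.map i.op = 0,
      (ShortComplex.mk (K.map p.op) (K.map i.op) w).ShortExact

/-- Weakly idempotent complete categories: every split epimorphism has a kernel. -/
def WeaklyIdempotentComplete (A : Type u) [Category.{v} A] [Preadditive A] : Prop :=
  ∀ ⦃M N : A⦄ (f : M ⟶ N), IsSplitEpi f → HasKernel f

/-- Krull–Schmidt categories: every object is a finite coproduct of objects with local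
endomorphism rings. -/
def KrullSchmidt (A : Type u) [Category.{v} A] [Preadditive A] : Prop :=
  ∀ M : A, ∃ (m : ℕ) (Y : Fin m → A) (ι : ∀ j, Y j ⟶ M),
    Nonempty (IsColimit (Cofan.mk M ι)) ∧ ∀ j, IsLocalRing (End (Y j))

end Exact

/-! ## Stable categories, the functors, and the categories `R` and `L` -/

namespace Extriangulation

variable {C : Type u} [Category.{v} C] [Preadditive C] [HasZeroObject C] [HasBinaryBiproducts C]
  (T : Extriangulation C)

lemma push_add_left {D M N : C} (f g : M ⟶ N) (δ : T.Ext D M) :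
    T.push (f + g) δ = T.push f δ + T.push g δ := by
  have := T.additive_right D
  simp [ExtData.push, Functor.map_add]

lemma pull_add_left {D D' M : C} (f g : D' ⟶ D) (δ : T.Ext D M) :
    T.pull (f + g) δ = T.pull f δ + T.pull g δ := by
  have := T.additive_left M
  have h : (T.E.flip.obj M).map (f.op + g.op) = _ := (T.E.flip.obj M).map_add
  exact congrArg (fun k => k.hom δ) h

lemma push_comp {D L M N : C} (f : L ⟶ M) (g : M ⟶ N) (δ : T.Ext D L) :
    T.push (f ≫ g) δ = T.push g (T.push f δ) := by
  simp [ExtData.push]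

lemma pull_comp {D D' D'' M : C} (f : D'' ⟶ D') (g : D' ⟶ D) (δ : T.Ext D M) :
    T.pull (f ≫ g) δ = T.pull f (T.pull g δ) := by
  simp [ExtData.pull]

lemma push_zero {D M N : C} (f : M ⟶ N) : T.push f (0 : T.Ext D M) = 0 := by
  simp [ExtData.push]

lemma pull_zero {D D' M : C} (f : D' ⟶ D) : T.pull f (0 : T.Ext D M) = 0 := by
  simp [ExtData.pull]

/-- The ideal `P₁(S)` of the morphisms `f` of the full subcategory `S` with `𝔼(f, -) = 0`. -/
def projIdeal (S : ObjectProperty C) : HomIdeal S.FullSubcategory where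
  carrier M N :=
    { carrier := {f | ∀ (Z : C) (δ : T.Ext N.obj Z), T.pull f.hom δ = 0}
      zero_mem' := fun Z δ => by
        have h := T.pull_add_left (0 : M.obj ⟶ N.obj) 0 δ
        rw [add_zero] at h
        exact left_eq_add.mp h
      add_mem' := fun {f g} hf hg Z δ => by
        change T.pull (f.hom + g.hom) δ = 0
        rw [T.pull_add_left, hf, hg, add_zero]
      neg_mem' := fun {f} hf Z δ => by
        have h : f.hom ≫ (-𝟙 N.obj) = (-f).hom := by
          change _ = -f.hom
          simp
        rw [← h, T.pull_comp, hf] }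
  precomp f g hg Z δ := by
    change T.pull (f.hom ≫ g.hom) δ = 0
    rw [T.pull_comp, hg, T.pull_zero]
  postcomp {_ _ _ f} g hf Z δ := by
    change T.pull (f.hom ≫ g.hom) δ = 0
    rw [T.pull_comp, hf]

/-- The ideal `I₁(S)` of the morphisms `f` of the full subcategory `S` with `𝔼(-, f) = 0`. -/
def injIdeal (S : ObjectProperty C) : HomIdeal S.FullSubcategory where
  carrier M N :=
    { carrier := {f | ∀ (Z : C) (δ : T.Ext Z M.obj), T.push f.hom δ = 0}
      zero_mem' := fun Z δ => by
        have h := T.push_add_left (0 : M.obj ⟶ N.obj) 0 δ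
        rw [add_zero] at h
        exact left_eq_add.mp h
      add_mem' := fun {f g} hf hg Z δ => by
        change T.push (f.hom + g.hom) δ = 0
        rw [T.push_add_left, hf, hg, add_zero]
      neg_mem' := fun {f} hf Z δ => by
        have h : (-𝟙 M.obj) ≫ f.hom = (-f).hom := by
          change _ = -f.hom
          simp
        rw [← h, T.push_comp, hf] }
  precomp f g hg Z δ := by
    change T.push (f.hom ≫ g.hom) δ = 0
    rw [T.push_comp, hg]
  postcomp {_ _ _ f} g hf Z δ := by
    change T.push (f.hom ≫ g.hom) δ = 0
    rw [T.push_comp, hf, T.push_zero]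

variable (X : ObjectProperty C) (n : ℕ)

/-- The stable category `X_n^∨ / P₁(X_n^∨)`. -/
abbrev Stable : Type u := (T.projIdeal (T.vee X n)).Quot

/-- The costable category `X_n^∧ / I₁(X_n^∧)`. -/
abbrev Costable : Type u := (T.injIdeal (T.wedge X n)).Quot

/-- The functor `M ↦ 𝔼(-, M)` with values in the contravariant functors on the stable
category of `X_n^∨`. -/
def functorH : C ⥤ (T.Stable X n)ᵒᵖ ⥤ AddCommGrpCat.{v} :=
  ((T.projIdeal (T.vee X n)).liftOp ((T.vee X n).ι.op ⋙ T.E) (fun M N f g hfg => by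
    ext Z δ
    have hadd := T.pull_add_left (f - g).hom g.hom δ
    have e : (f - g).hom + g.hom = f.hom := by
      change f.hom - g.hom + g.hom = f.hom
      abel
    rw [e, hfg Z δ, zero_add] at hadd
    exact hadd)).flip

/-- The contravariant functor `M ↦ 𝔼(M, -)` with values in the covariant functors on the
costable category of `X_n^∧`. -/
def functorG : Cᵒᵖ ⥤ T.Costable X n ⥤ AddCommGrpCat.{v} :=
  ((T.injIdeal (T.wedge X n)).lift ((T.wedge X n).ι ⋙ T.E.flip) (fun M N f g hfg => by
    ext Z δ
    have hadd := T.push_add_left (f - g).hom g.hom δ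
    have e : (f - g).hom + g.hom = f.hom := by
      change f.hom - g.hom + g.hom = f.hom
      abel
    rw [e, hfg Z.unop δ, zero_add] at hadd
    exact hadd)).flip

instance : (T.functorH X n).Additive where
  map_add {M N f g} := by
    ext Z δ
    exact T.push_add_left f g δ

instance : (T.functorG X n).Additive where
  map_add {M N f g} := by
    ext Z δ
    exact T.pull_add_left f.unop g.unop δ

variable {X n} in
/-- The functor `F : C / I ⟶ Mod` induced by `functorH`, for an ideal `I` contained in its
kernel. -/
def functorF (I : HomIdeal C)
    (h : ∀ ⦃M N : C⦄ (f : M ⟶ N), f ∈ I.carrier M N → (T.functorH X n).map f = 0) :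
    I.Quot ⥤ (T.Stable X n)ᵒᵖ ⥤ AddCommGrpCat.{v} :=
  I.lift (T.functorH X n) (fun M N f g hfg => by
    rw [← sub_eq_zero, ← Functor.map_sub, h _ hfg])

variable {X n} in
/-- The contravariant functor `K` on `C / I` induced by `functorG`, for an ideal `I` contained in
its kernel. -/
def functorK (I : HomIdeal C)
    (h : ∀ ⦃M N : C⦄ (f : M ⟶ N), f ∈ I.carrier M N → (T.functorG X n).map f.op = 0) :
    I.Quotᵒᵖ ⥤ T.Costable X n ⥤ AddCommGrpCat.{v} :=
  I.liftOp (T.functorG X n) (fun M N f g hfg => by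
    rw [← sub_eq_zero, ← Functor.map_sub, ← op_sub, h _ hfg])

/-- `R_X^n`: the right modules `G` over the stable category of `X_n^∨` (additive contravariant
functors to abelian groups) with an exact sequence `Hom(-, X₀) ⟶ Hom(-, X₁) ⟶ G ⟶ 0`, where
`X₀ ∈ X` and `X₁ ∈ X_n^∨`. -/
def catR : ObjectProperty ((T.Stable X n)ᵒᵖ ⥤ AddCommGrpCat.{v}) := fun G =>
  G.Additive ∧ ∃ (X₀ X₁ : (T.vee X n).FullSubcategory) (_ : X X₀.obj)
    (α : preadditiveYoneda.obj ((T.projIdeal (T.vee X n)).proj.obj X₀) ⟶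
      preadditiveYoneda.obj ((T.projIdeal (T.vee X n)).proj.obj X₁))
    (β : preadditiveYoneda.obj ((T.projIdeal (T.vee X n)).proj.obj X₁) ⟶ G)
    (w : α ≫ β = 0), (ShortComplex.mk α β w).Exact ∧ Epi β

/-- `L_X^n`: the left modules `G` over the costable category of `X_n^∧` (additive covariant
functors to abelian groups) with an exact sequence `Hom(X₀, -) ⟶ Hom(X₁, -) ⟶ G ⟶ 0`, where
`X₀ ∈ X` and `X₁ ∈ X_n^∧`. -/
def catL : ObjectProperty (T.Costable X n ⥤ AddCommGrpCat.{v}) := fun G =>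
  G.Additive ∧ ∃ (X₀ X₁ : (T.wedge X n).FullSubcategory) (_ : X X₀.obj)
    (α : preadditiveCoyoneda.obj (op ((T.injIdeal (T.wedge X n)).proj.obj X₀)) ⟶
      preadditiveCoyoneda.obj (op ((T.injIdeal (T.wedge X n)).proj.obj X₁)))
    (β : preadditiveCoyoneda.obj (op ((T.injIdeal (T.wedge X n)).proj.obj X₁)) ⟶ G)
    (w : α ≫ β = 0), (ShortComplex.mk α β w).Exact ∧ Epi β

variable {T X n}

/-- A cluster tilting subcategory is closed under finite direct sums, so that `[X]` is an ideal. -/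
lemma IsClusterTilting.closedUnderSums {hI : T.EnoughEInj} (hX : T.IsClusterTilting hI n X) :
    ClosedUnderSums X where
  zero := by

    obtain ⟨Z, hZ⟩ := HasZeroObject.zero (C := C)
    refine ⟨Z, hZ, (hX.left_orthogonal Z).2 fun k _ X' _ => ⟨fun δ δ' => ?_⟩⟩
    have key : ∀ δ : T.Ext Z ((cosyzygy hI)^[k] X'), δ = 0 := fun δ => by
      have h := T.pull_add_left (𝟙 Z) (𝟙 Z) δ
      rw [hZ.eq_of_src (𝟙 Z + 𝟙 Z) (𝟙 Z)] at h
      have h1 : T.pull (𝟙 Z) δ = δ := by simp [ExtData.pull]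
      rw [h1] at h
      exact left_eq_add.mp h
    rw [key δ, key δ']
  biprod M N hM hN := by
    refine (hX.left_orthogonal _).2 fun k hk X' hX' => ⟨fun δ δ' => ?_⟩
    have h₁ := (hX.left_orthogonal M).1 hM k hk X' hX'
    have h₂ := (hX.left_orthogonal N).1 hN k hk X' hX'
    have key : ∀ δ : T.Ext (M ⊞ N) ((cosyzygy hI)^[k] X'), δ = 0 := fun δ => by
      have h := T.pull_add_left (biprod.fst ≫ biprod.inl) (biprod.snd ≫ biprod.inr) δ
      have h1 : T.pull (𝟙 (M ⊞ N)) δ = δ := by simp [ExtData.pull]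
      rw [biprod.total, h1, T.pull_comp, T.pull_comp,
        Subsingleton.elim (T.pull biprod.inl δ) 0, Subsingleton.elim (T.pull biprod.inr δ) 0,
        T.pull_zero, T.pull_zero, add_zero] at h
      exact h
    rw [key δ, key δ']

/-- The ideal `[X]` for a cluster tilting subcategory `X`. -/
def IsClusterTilting.ideal {hI : T.EnoughEInj} (hX : T.IsClusterTilting hI n X) : HomIdeal C :=
  factorIdeal X hX.closedUnderSums

end Extriangulation

end ClusterQuotient

end

/-!
The whole argument takes place in degree one. If `X` is `(n+2)`-cluster tilting, then dimension
shifting along `X`-preenvelopes and `X`-precovers shows that `X_n^∨ = {D | 𝔼(D, X) = 0}` and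
`X_n^∧ = {D | 𝔼(X, D) = 0}` (`IsClusterTilting.vee_iff`, `IsClusterTilting.wedge_iff`). As
`𝔼(X, X) = 0`, the cokernel of an `X`-preenvelope lies in `X_n^∨` and the kernel of an `X`-precover
in `X_n^∧`; in particular `X_{n+1}^∨` and `X_{n+1}^∧` are everything.

Let `M ⟶ X₀ ⟶ L` be such a conflation, with class `δ ∈ 𝔼(L, M)`. Since `𝔼(-, X₀)` vanishes on
`X_n^∨`, each element of `𝔼(Z, M)` with `Z ∈ X_n^∨` is a pullback of `δ`, and the pullback along
`c : Z ⟶ L` is zero if and only if `c` factors through `X₀`: the functor `𝔼(-, M)` is presented by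
`Hom(-, X₀) ⟶ Hom(-, L)` with generator `δ` (`isPresentation_functorH`). Moreover an element of
`𝔼(L, N)` that dies on `X₀` is a pushout of `δ` along some `M ⟶ N` (`isVersal_functorH`). Hence
`M ↦ 𝔼(-, M)` is full, and a morphism `f` is killed if and only if `f` sends `δ` to zero, that is,
if and only if `f` factors through `X₀`. Conversely a presentation by a morphism `X₀ ⟶ X₁` can be
replaced by one by a deflation, after adding to `X₀` a projective object, which is zero in the
stable category; then it presents `𝔼(-, M)` for the kernel `M` of the deflation
(`exists_iso_functorH`). So `C / [X]` is equivalent to `R`, and dually anti-equivalent to `L`.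

By the horseshoe lemma (`finPresented_of_shortExact`), `R` and `L` are closed under extensions in
the abelian categories of all functors to abelian groups. A full subcategory closed under extensions
is exact (`isExactCategory_inducedClass`), which gives all the exact structures at once. Weak
idempotent completeness is checked in `C / [X]` directly: a split epimorphism lifts, after adding
summands which vanish in the quotient, to a split deflation of `C`.
-/

namespace ClusterQuotient

namespace Extriangulation

variable {C : Type u} [Category.{v} C] [Preadditive C] [HasZeroObject C] [HasBinaryBiproducts C]
  (T : Extriangulation C)

/-! ### Exact sequences attached to a conflation -/

lemma push_id {D A : C} (δ : T.Ext D A) : T.push (𝟙 A) δ = δ := by simp [ExtData.push]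

lemma pull_id {D A : C} (δ : T.Ext D A) : T.pull (𝟙 D) δ = δ := by simp [ExtData.pull]

lemma exists_realizes {D A : C} (δ : T.Ext D A) :
    ∃ (B : C) (x : A ⟶ B) (y : B ⟶ D), T.Realizes x y δ := by
  obtain ⟨⟨B, x, y⟩, h⟩ := Quotient.exists_rep (T.s δ)
  exact ⟨B, x, y, h.symm⟩

variable {T}

lemma realizes_of_iso {A B B' D : C} {x : A ⟶ B} {y : B ⟶ D} {δ : T.Ext D A}
    (h : T.Realizes x y δ) (b : B ≅ B') {x' : A ⟶ B'} {y' : B' ⟶ D} (hx : x ≫ b.hom = x')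
    (hy : b.hom ≫ y' = y) : T.Realizes x' y' δ :=
  Eq.trans (α := SeqClass C A D) h (Quotient.sound ⟨b, hx, hy⟩)

/-- A realization of the zero extension splits. -/
lemma exists_iso_of_realizes_zero {A B D : C} {x : A ⟶ B} {y : B ⟶ D}
    (h : T.Realizes x y (0 : T.Ext D A)) :
    ∃ b : (A ⊞ D) ≅ B, biprod.inl ≫ b.hom = x ∧ b.hom ≫ y = biprod.snd :=
  Quotient.exact (((T.realizes_zero A D).symm).trans h)

section Exactness

variable {A B D : C} {x : A ⟶ B} {y : B ⟶ D} {δ : T.Ext D A} (h : T.Realizes x y δ)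
include h

lemma push_inf : T.push x δ = 0 := by
  obtain ⟨c, -, hc⟩ := T.ET3 _ _ _ _ _ _ h (T.realizes_zero B D) x biprod.inl rfl
  rw [hc, T.pull_zero]

lemma pull_defl : T.pull y δ = 0 := by
  obtain ⟨a, -, ha⟩ := T.ET3op _ _ _ _ _ _ (T.realizes_zero A B) h biprod.snd y rfl
  rw [← ha, T.push_zero]

lemma push_eq_zero_iff {N : C} (f : A ⟶ N) : T.push f δ = 0 ↔ ∃ g : B ⟶ N, x ≫ g = f := by
  constructor
  · intro hf
    obtain ⟨b, hb, -⟩ := T.realization _ _ _ _ _ _ h (T.realizes_zero N D) f (𝟙 D)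
      (by rw [hf, T.pull_zero])
    exact ⟨b ≫ biprod.fst, by rw [← Category.assoc, hb]; simp⟩
  · rintro ⟨g, rfl⟩
    rw [T.push_comp, push_inf h, T.push_zero]

lemma pull_eq_zero_iff {Z : C} (c : Z ⟶ D) : T.pull c δ = 0 ↔ ∃ g : Z ⟶ B, g ≫ y = c := by
  constructor
  · intro hc
    obtain ⟨b, -, hb⟩ := T.realization _ _ _ _ _ _ (T.realizes_zero A Z) h (𝟙 A) c
      (by rw [hc, T.push_zero])
    exact ⟨biprod.inr ≫ b, by rw [Category.assoc, ← hb]; simp⟩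
  · rintro ⟨g, rfl⟩
    rw [T.pull_comp, pull_defl h, T.pull_zero]

lemma exists_push_eq {N : C} (ε : T.Ext D N) (hε : T.pull y ε = 0) :
    ∃ f : A ⟶ N, T.push f δ = ε := by
  obtain ⟨E, x', y', h'⟩ := T.exists_realizes ε
  obtain ⟨g, hg⟩ := (pull_eq_zero_iff h' y).1 hε
  obtain ⟨a, -, ha⟩ := T.ET3op _ _ _ _ _ _ h h' g (𝟙 D) (by simp [hg])
  exact ⟨a, by rw [ha, T.pull_id]⟩

lemma exists_pull_eq {Z : C} (ε : T.Ext Z A) (hε : T.push x ε = 0) :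
    ∃ c : Z ⟶ D, T.pull c δ = ε := by
  obtain ⟨E, x', y', h'⟩ := T.exists_realizes ε
  obtain ⟨g, hg⟩ := (push_eq_zero_iff h' x).1 hε
  obtain ⟨c, -, hc⟩ := T.ET3 _ _ _ _ _ _ h' h (𝟙 A) g (by simp [hg])
  exact ⟨c, by rw [← hc, T.push_id]⟩

end Exactness

/-! ### Projective and injective objects -/

lemma EProj.ext_eq_zero {P : C} (hP : T.EProj P) {A : C} (δ : T.Ext P A) : δ = 0 := by
  obtain ⟨B, x, y, h⟩ := T.exists_realizes δ
  rw [← T.pull_id δ]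
  exact (pull_eq_zero_iff h _).2 (hP x y ⟨δ, h⟩ _)

lemma EInj.ext_eq_zero {I : C} (hI : T.EInj I) {D : C} (δ : T.Ext D I) : δ = 0 := by
  obtain ⟨B, x, y, h⟩ := T.exists_realizes δ
  rw [← T.push_id δ]
  exact (push_eq_zero_iff h _).2 (hI x y ⟨δ, h⟩ _)

/-- If `p : P ⟶ D` is a deflation, then so is `(f, p) : A ⊞ P ⟶ D` for each `f : A ⟶ D`: it is the
composite of `1 ⊞ p : A ⊞ P ⟶ A ⊞ D` with the split deflation `(f, 1) : A ⊞ D ⟶ D`. -/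
lemma conflation_desc {A D K P : C} (f : A ⟶ D) {k : K ⟶ P} {p : P ⟶ D}
    (h : T.Conflation k p) : ∃ (L : C) (l : L ⟶ A ⊞ P), T.Conflation l (biprod.desc f p) := by
  obtain ⟨δ, h⟩ := h
  obtain ⟨Z, hZ⟩ := HasZeroObject.zero (C := C)
  -- `0 ⟶ A ⟶ A`, to be added to the given conflation
  have h₀ : T.Realizes (0 : Z ⟶ A) (𝟙 A) (0 : T.Ext A Z) :=
    realizes_of_iso (T.realizes_zero Z A)
      ⟨biprod.snd, biprod.inr, by ext <;> simp [hZ.eq_of_src _ 0, hZ.eq_of_tgt _ 0], by simp⟩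
      (hZ.eq_of_src _ _) (by simp)
  have h₁ := T.realizes_directSum _ _ _ _ _ _ h₀ h
  -- the split conflation of `(f, 1)`, obtained from the canonical one by a shear of `A ⊞ D`
  have h₂ : T.Realizes (biprod.lift (𝟙 A) (-f)) (biprod.desc f (𝟙 D)) (0 : T.Ext D A) :=
    realizes_of_iso (T.realizes_zero A D)
      ⟨biprod.desc (biprod.lift (𝟙 A) (-f)) biprod.inr,
        biprod.desc (biprod.lift (𝟙 A) f) biprod.inr,
        by ext <;> simp, by ext <;> simp⟩
      (by simp) (by ext <;> simp)
  obtain ⟨N, d, e, l, δ', -, -, h', -⟩ := T.ET4op _ _ _ _ _ _ h₁ h₂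
  refine ⟨N, l, δ', ?_⟩
  convert h' using 1
  ext <;> simp

/-- If `j : D ⟶ I` is an inflation, then so is `(f, j) : D ⟶ A ⊞ I` for each `f : D ⟶ A`. -/
lemma conflation_lift {A D K I : C} (f : D ⟶ A) {j : D ⟶ I} {k : I ⟶ K}
    (h : T.Conflation j k) : ∃ (L : C) (l : A ⊞ I ⟶ L), T.Conflation (biprod.lift f j) l := by
  obtain ⟨δ, h⟩ := h
  obtain ⟨Z, hZ⟩ := HasZeroObject.zero (C := C)
  have h₀ : T.Realizes (𝟙 A) (0 : A ⟶ Z) (0 : T.Ext Z A) :=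
    realizes_of_iso (T.realizes_zero A Z)
      ⟨biprod.fst, biprod.inl, by ext <;> simp [hZ.eq_of_src _ 0, hZ.eq_of_tgt _ 0], by simp⟩
      (by simp) (hZ.eq_of_tgt _ _)
  have h₁ := T.realizes_directSum _ _ _ _ _ _ h₀ h
  have h₂ : T.Realizes (biprod.lift f (𝟙 D)) (biprod.desc (𝟙 A) (-f)) (0 : T.Ext A D) :=
    realizes_of_iso (T.realizes_zero D A)
      ⟨biprod.desc (biprod.lift f (𝟙 D)) biprod.inl,
        biprod.lift biprod.snd (biprod.desc (𝟙 A) (-f)),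
        by ext <;> simp, by ext <;> simp⟩
      (by simp) (by ext <;> simp)
  obtain ⟨N, l, d, e, δ', -, -, h', -⟩ := T.ET4 _ _ _ _ _ _ h₂ h₁
  refine ⟨N, l, δ', ?_⟩
  convert h' using 1
  ext <;> simp

/-! ### Dimension shifting -/

lemma cosyzygy_spec (hI : T.EnoughEInj) (A : C) :
    ∃ (I : C) (x : A ⟶ I) (y : I ⟶ cosyzygy hI A), T.EInj I ∧ T.Conflation x y :=
  ⟨_, (hI A).choose_spec.choose_spec⟩

/-- A chosen syzygy `Ω D`, given by a conflation `Ω D ⟶ P ⟶ D` with `P` projective. -/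
noncomputable def syzygy (hP : T.EnoughEProj) (D : C) : C := (hP D).choose

lemma syzygy_spec (hP : T.EnoughEProj) (D : C) :
    ∃ (P : C) (x : syzygy hP D ⟶ P) (y : P ⟶ D), T.EProj P ∧ T.Conflation x y :=
  (hP D).choose_spec

/-- Both groups are quotients of `Hom(Ω D, Σ A)`, and the maps `Ω D ⟶ Σ A` which factor through a
projective are those which factor through an injective. -/
lemma subsingleton_ext_cosyzygy_iff (hP : T.EnoughEProj) (hI : T.EnoughEInj) (D A : C) :
    Subsingleton (T.Ext D (cosyzygy hI A)) ↔ Subsingleton (T.Ext (syzygy hP D) A) := by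
  obtain ⟨I, i, j, hII, ι, hι⟩ := cosyzygy_spec hI A
  obtain ⟨P, k, p, hPP, π, hπ⟩ := syzygy_spec hP D
  constructor
  · intro hs
    refine subsingleton_of_forall_eq 0 fun ε => ?_
    obtain ⟨c, rfl⟩ := exists_pull_eq hι ε (hII.ext_eq_zero _)
    obtain ⟨c', rfl⟩ := (push_eq_zero_iff hπ c).1 (Subsingleton.elim _ _)
    rw [T.pull_comp, hPP.ext_eq_zero (T.pull c' ι), T.pull_zero]
  · intro hs
    refine subsingleton_of_forall_eq 0 fun ε => ?_
    obtain ⟨c, rfl⟩ := exists_push_eq hπ ε (hPP.ext_eq_zero _)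
    obtain ⟨c', rfl⟩ := (pull_eq_zero_iff hι c).1 (Subsingleton.elim _ _)
    rw [T.push_comp, hII.ext_eq_zero (T.push c' π), T.push_zero]

lemma subsingleton_higherExt_iff (hP : T.EnoughEProj) (hI : T.EnoughEInj) (k : ℕ) (D A : C) :
    Subsingleton (higherExt hI k D A) ↔ Subsingleton (T.Ext ((syzygy hP)^[k] D) A) := by
  induction k generalizing D with
  | zero => rfl
  | succ k ih =>
    rw [Function.iterate_succ_apply, ← ih, ← subsingleton_ext_cosyzygy_iff hP hI,
      higherExt, Function.iterate_succ_apply']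

section Shift

variable {A B D : C} {x : A ⟶ B} {y : B ⟶ D} (h : T.Conflation x y)
include h

/-- Exactness of `𝔼(A, M) ⟶ 𝔼²(D, M) ⟶ 𝔼²(B, M)`. -/
lemma subsingleton_ext_defl_cosyzygy (hI : T.EnoughEInj) {M : C} (hA : Subsingleton (T.Ext A M))
    (hB : Subsingleton (T.Ext B (cosyzygy hI M))) : Subsingleton (T.Ext D (cosyzygy hI M)) := by
  obtain ⟨δ, h⟩ := h
  obtain ⟨I, i, j, hII, ι, hι⟩ := cosyzygy_spec hI M
  refine subsingleton_of_forall_eq 0 fun ε => ?_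
  obtain ⟨c, rfl⟩ := exists_push_eq h ε (Subsingleton.elim _ _)
  obtain ⟨c', rfl⟩ := (pull_eq_zero_iff hι c).1 (Subsingleton.elim _ _)
  rw [T.push_comp, hII.ext_eq_zero (T.push c' δ), T.push_zero]

/-- Exactness of `𝔼(B, M) ⟶ 𝔼(A, M) ⟶ 𝔼²(D, M)`. -/
lemma subsingleton_ext_inf (hI : T.EnoughEInj) {M : C} (hB : Subsingleton (T.Ext B M))
    (hD : Subsingleton (T.Ext D (cosyzygy hI M))) : Subsingleton (T.Ext A M) := by
  obtain ⟨δ, h⟩ := h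
  obtain ⟨I, i, j, hII, ι, hι⟩ := cosyzygy_spec hI M
  refine subsingleton_of_forall_eq 0 fun ε => ?_
  obtain ⟨c, rfl⟩ := exists_pull_eq hι ε (hII.ext_eq_zero _)
  obtain ⟨c', rfl⟩ := (push_eq_zero_iff h c).1 (Subsingleton.elim _ _)
  rw [T.pull_comp, Subsingleton.elim (T.pull c' ι) 0, T.pull_zero]

/-- Exactness of `𝔼(M, D) ⟶ 𝔼²(M, A) ⟶ 𝔼²(M, B)`. -/
lemma subsingleton_ext_syzygy_inf (hP : T.EnoughEProj) {M : C} (hD : Subsingleton (T.Ext M D))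
    (hB : Subsingleton (T.Ext (syzygy hP M) B)) : Subsingleton (T.Ext (syzygy hP M) A) := by
  obtain ⟨δ, h⟩ := h
  obtain ⟨P, k, p, hPP, π, hπ⟩ := syzygy_spec hP M
  refine subsingleton_of_forall_eq 0 fun ε => ?_
  obtain ⟨c, rfl⟩ := exists_pull_eq h ε (Subsingleton.elim _ _)
  obtain ⟨c', rfl⟩ := (push_eq_zero_iff hπ c).1 (Subsingleton.elim _ _)
  rw [T.pull_comp, hPP.ext_eq_zero (T.pull c' δ), T.pull_zero]

/-- Exactness of `𝔼(M, B) ⟶ 𝔼(M, D) ⟶ 𝔼²(M, A)`. -/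
lemma subsingleton_ext_defl (hP : T.EnoughEProj) {M : C} (hB : Subsingleton (T.Ext M B))
    (hA : Subsingleton (T.Ext (syzygy hP M) A)) : Subsingleton (T.Ext M D) := by
  obtain ⟨δ, h⟩ := h
  obtain ⟨P, k, p, hPP, π, hπ⟩ := syzygy_spec hP M
  refine subsingleton_of_forall_eq 0 fun ε => ?_
  obtain ⟨c, rfl⟩ := exists_push_eq hπ ε (hPP.ext_eq_zero _)
  obtain ⟨c', rfl⟩ := (pull_eq_zero_iff h c).1 (Subsingleton.elim _ _)
  rw [T.push_comp, Subsingleton.elim (T.push c' π) 0, T.push_zero]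

end Shift

/-! ### Cluster tilting subcategories -/

namespace IsClusterTilting

variable {hI : T.EnoughEInj} {n : ℕ} {X : ObjectProperty C}

lemma of_proj (hX : T.IsClusterTilting hI n X) {P : C} (hP : T.EProj P) : X P :=
  (hX.left_orthogonal P).2 fun _ _ _ _ => subsingleton_of_forall_eq 0 hP.ext_eq_zero

lemma of_inj (hX : T.IsClusterTilting hI n X) (hP : T.EnoughEProj) {I : C} (hII : T.EInj I) :
    X I :=
  (hX.right_orthogonal I).2 fun k _ X' _ =>
    (subsingleton_higherExt_iff hP hI k X' I).2 (subsingleton_of_forall_eq 0 hII.ext_eq_zero)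

lemma isClosedUnderIsomorphisms (hX : T.IsClusterTilting hI n X) :
    X.IsClosedUnderIsomorphisms where
  of_iso {M N} e hM := by
    refine (hX.left_orthogonal N).2 fun k hk X' hX' => ?_
    have := (hX.left_orthogonal M).1 hM k hk X' hX'
    refine subsingleton_of_forall_eq 0 fun ε => ?_
    rw [← T.pull_id ε, ← e.inv_hom_id, T.pull_comp, Subsingleton.elim (T.pull e.hom ε) 0,
      T.pull_zero]

lemma subsingleton_ext (hX : T.IsClusterTilting hI n X) {M N : C} (hM : X M) (hN : X N) :
    Subsingleton (T.Ext M N) :=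
  (hX.left_orthogonal M).1 hM 0 (Nat.zero_le n) N hN

/-- The cokernel of an `X`-preenvelope has no extensions by `X`. -/
lemma exists_conflation_left (hX : T.IsClusterTilting hI n X) (M : C) :
    ∃ (X₀ L : C) (x : M ⟶ X₀) (y : X₀ ⟶ L), T.Conflation x y ∧ X X₀ ∧
      ∀ X', X X' → Subsingleton (T.Ext L X') := by
  obtain ⟨X₀, L, x, y, ⟨δ, h⟩, hX₀, hx⟩ := hX.preenveloping M
  refine ⟨X₀, L, x, y, ⟨δ, h⟩, hX₀, fun X' hX' => subsingleton_of_forall_eq 0 fun ε => ?_⟩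
  have := hX.subsingleton_ext hX₀ hX'
  obtain ⟨f, rfl⟩ := exists_push_eq h ε (Subsingleton.elim _ _)
  exact (push_eq_zero_iff h f).2 (hx X' hX' f)

/-- The kernel of an `X`-precover has no extensions of `X` by it. -/
lemma exists_conflation_right (hX : T.IsClusterTilting hI n X) (M : C) :
    ∃ (L X₀ : C) (x : L ⟶ X₀) (y : X₀ ⟶ M), T.Conflation x y ∧ X X₀ ∧
      ∀ X', X X' → Subsingleton (T.Ext X' L) := by
  obtain ⟨L, X₀, x, y, ⟨δ, h⟩, hX₀, hy⟩ := hX.precovering M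
  refine ⟨L, X₀, x, y, ⟨δ, h⟩, hX₀, fun X' hX' => subsingleton_of_forall_eq 0 fun ε => ?_⟩
  have := hX.subsingleton_ext hX' hX₀
  obtain ⟨f, rfl⟩ := exists_pull_eq h ε (Subsingleton.elim _ _)
  exact (pull_eq_zero_iff h f).2 (hy X' hX' f)

/-- If `𝔼^i(D, X) = 0` for `1 ≤ i ≤ n - m + 1`, then `D` has an `X`-coresolution of length `m`:
passing to the cokernel of an `X`-preenvelope gains one degree of vanishing. -/
lemma hasCoresolution (hX : T.IsClusterTilting hI n X) (m : ℕ) (hm : m ≤ n) (D : C)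
    (hD : ∀ k ≤ n - m, ∀ X', X X' → Subsingleton (higherExt hI k D X')) :
    T.HasCoresolution X m D := by
  induction m generalizing D with
  | zero => exact X.le_isoClosure _ ((hX.left_orthogonal D).2 hD)
  | succ m ih =>
    obtain ⟨X₀, L, x, y, h, hX₀, hL⟩ := hX.exists_conflation_left D
    refine ⟨X₀, L, x, y, h, hX₀, ih (by omega) L fun k hk X' hX' => ?_⟩
    cases k with
    | zero => exact hL X' hX'
    | succ k =>
      have h₀ := (hX.left_orthogonal X₀).1 hX₀ (k + 1) (by omega) X' hX'
      rw [higherExt, Function.iterate_succ_apply'] at h₀ ⊢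
      exact subsingleton_ext_defl_cosyzygy h hI (hD k (by omega) X' hX') h₀

/-- If `𝔼^i(X, D) = 0` for `1 ≤ i ≤ n - m + 1`, then `D` has an `X`-resolution of length `m`:
passing to the kernel of an `X`-precover gains one degree of vanishing. -/
lemma hasResolution (hX : T.IsClusterTilting hI n X) (hP : T.EnoughEProj) (m : ℕ) (hm : m ≤ n)
    (D : C) (hD : ∀ k ≤ n - m, ∀ X', X X' → Subsingleton (higherExt hI k X' D)) :
    T.HasResolution X m D := by
  induction m generalizing D with
  | zero => exact X.le_isoClosure _ ((hX.right_orthogonal D).2 hD)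
  | succ m ih =>
    obtain ⟨L, X₀, x, y, h, hX₀, hL⟩ := hX.exists_conflation_right D
    refine ⟨L, X₀, x, y, h, hX₀, ih (by omega) L fun k hk X' hX' => ?_⟩
    cases k with
    | zero => exact hL X' hX'
    | succ k =>
      have h₀ := (hX.right_orthogonal X₀).1 hX₀ (k + 1) (by omega) X' hX'
      have h₁ := hD k (by omega) X' hX'
      rw [subsingleton_higherExt_iff hP] at h₁
      rw [subsingleton_higherExt_iff hP, Function.iterate_succ_apply'] at h₀ ⊢
      exact subsingleton_ext_syzygy_inf h hP h₁ h₀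

/-- Each step of an `X`-coresolution costs one degree of vanishing of `𝔼^i(-, X)`. -/
lemma subsingleton_of_hasCoresolution (hX : T.IsClusterTilting hI n X) (m : ℕ) (hm : m ≤ n)
    (D : C) (hD : T.HasCoresolution X m D) (k : ℕ) (hk : k ≤ n - m) (X' : C) (hX' : X X') :
    Subsingleton (higherExt hI k D X') := by
  induction m generalizing D k with
  | zero =>
    have := hX.isClosedUnderIsomorphisms
    rw [HasCoresolution, X.isoClosure_eq_self] at hD
    exact (hX.left_orthogonal D).1 hD k hk X' hX'
  | succ m ih =>
    obtain ⟨X₀, L, x, y, h, hX₀, hL⟩ := hD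
    have hL' := ih (by omega) L hL (k + 1) (by omega)
    rw [higherExt, Function.iterate_succ_apply'] at hL'
    exact subsingleton_ext_inf h hI ((hX.left_orthogonal X₀).1 hX₀ k (by omega) X' hX') hL'

/-- Each step of an `X`-resolution costs one degree of vanishing of `𝔼^i(X, -)`. -/
lemma subsingleton_of_hasResolution (hX : T.IsClusterTilting hI n X) (hP : T.EnoughEProj) (m : ℕ)
    (hm : m ≤ n) (D : C) (hD : T.HasResolution X m D) (k : ℕ) (hk : k ≤ n - m) (X' : C)
    (hX' : X X') : Subsingleton (higherExt hI k X' D) := by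
  induction m generalizing D k with
  | zero =>
    have := hX.isClosedUnderIsomorphisms
    rw [HasResolution, X.isoClosure_eq_self] at hD
    exact (hX.right_orthogonal D).1 hD k hk X' hX'
  | succ m ih =>
    obtain ⟨L, X₀, x, y, h, hX₀, hL⟩ := hD
    have hL' := ih (by omega) L hL (k + 1) (by omega)
    have h₀ := (hX.right_orthogonal X₀).1 hX₀ k (by omega) X' hX'
    rw [subsingleton_higherExt_iff hP, Function.iterate_succ_apply'] at hL'
    rw [subsingleton_higherExt_iff hP] at h₀ ⊢
    exact subsingleton_ext_defl h hP h₀ hL'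

/-- `X_n^∨` is the left orthogonal of `X` with respect to `𝔼`. -/
lemma vee_iff (hX : T.IsClusterTilting hI n X) (D : C) :
    T.vee X n D ↔ ∀ X', X X' → Subsingleton (T.Ext D X') := by
  refine ⟨?_, fun h => ⟨n, le_rfl, hX.hasCoresolution n le_rfl D fun k hk => ?_⟩⟩
  · rintro ⟨m, hm, h⟩ X' hX'
    exact hX.subsingleton_of_hasCoresolution m hm D h 0 (Nat.zero_le _) X' hX'
  · obtain rfl : k = 0 := by omega
    exact h

/-- `X_n^∧` is the right orthogonal of `X` with respect to `𝔼`. -/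
lemma wedge_iff (hX : T.IsClusterTilting hI n X) (hP : T.EnoughEProj) (D : C) :
    T.wedge X n D ↔ ∀ X', X X' → Subsingleton (T.Ext X' D) := by
  refine ⟨?_, fun h => ⟨n, le_rfl, hX.hasResolution hP n le_rfl D fun k hk => ?_⟩⟩
  · rintro ⟨m, hm, h⟩ X' hX'
    exact hX.subsingleton_of_hasResolution hP m hm D h 0 (Nat.zero_le _) X' hX'
  · obtain rfl : k = 0 := by omega
    exact h

lemma vee_succ_eq_top (hX : T.IsClusterTilting hI n X) : T.vee X (n + 1) = ⊤ := by
  refine top_le_iff.1 fun D _ => ?_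
  obtain ⟨X₀, L, x, y, h, hX₀, hL⟩ := hX.exists_conflation_left D
  refine ⟨n + 1, le_rfl, X₀, L, x, y, h, hX₀, hX.hasCoresolution n le_rfl L fun k hk => ?_⟩
  obtain rfl : k = 0 := by omega
  exact hL

lemma wedge_succ_eq_top (hX : T.IsClusterTilting hI n X) (hP : T.EnoughEProj) :
    T.wedge X (n + 1) = ⊤ := by
  refine top_le_iff.1 fun D _ => ?_
  obtain ⟨L, X₀, x, y, h, hX₀, hL⟩ := hX.exists_conflation_right D
  refine ⟨n + 1, le_rfl, L, X₀, x, y, h, hX₀, hX.hasResolution hP n le_rfl L fun k hk => ?_⟩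
  obtain rfl : k = 0 := by omega
  exact hL

end IsClusterTilting

end Extriangulation

section Presentations

/-! ### Finitely presented functors to abelian groups -/

variable {W : Type u} [Category.{v} W]

lemma map_comp_apply' (G : W ⥤ AddCommGrpCat.{v'}) {A B D : W} (f : A ⟶ B) (g : B ⟶ D)
    (s : G.obj A) : G.map (f ≫ g) s = G.map g (G.map f s) := by
  rw [G.map_comp]; rfl

lemma map_id_apply' (G : W ⥤ AddCommGrpCat.{v'}) {A : W} (s : G.obj A) : G.map (𝟙 A) s = s := by
  rw [G.map_id]; rfl

lemma naturality_apply' {G H : W ⥤ AddCommGrpCat.{v'}} (φ : G ⟶ H) {A B : W} (f : A ⟶ B)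
    (s : G.obj A) : φ.app B (G.map f s) = H.map f (φ.app A s) :=
  congrArg (fun k => k.hom s) (φ.naturality f)

lemma hom_ext_of_generates {P G : W ⥤ AddCommGrpCat.{v'}} {A : W} {u : P.obj A}
    (hu : ∀ (Z : W) (t : P.obj Z), ∃ c : A ⟶ Z, P.map c u = t) {φ ψ : P ⟶ G}
    (h : φ.app A u = ψ.app A u) : φ = ψ := by
  ext Z t
  obtain ⟨c, rfl⟩ := hu Z t
  change φ.app Z _ = ψ.app Z _
  rw [naturality_apply', naturality_apply', h]

variable [Preadditive W]

/-- `s ∈ G(A)` generates the functor `G`, and its relations are generated by `g : A ⟶ B`. By the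
Yoneda lemma this is an exact sequence `Hom(B, -) ⟶ Hom(A, -) ⟶ G ⟶ 0`. -/
structure IsPresentation (G : W ⥤ AddCommGrpCat.{v'}) {A B : W} (g : A ⟶ B) (s : G.obj A) :
    Prop where
  generates : ∀ (Z : W) (t : G.obj Z), ∃ c : A ⟶ Z, G.map c s = t
  map_eq_zero : G.map g s = 0
  exists_fac : ∀ (Z : W) (c : A ⟶ Z), G.map c s = 0 → ∃ d : B ⟶ Z, g ≫ d = c

/-- Additive functors with a presentation whose relations are indexed by an object of `Q`. -/
def FinPresented (Q : ObjectProperty W) : ObjectProperty (W ⥤ AddCommGrpCat.{v'}) := fun G =>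
  G.Additive ∧ ∃ (A B : W) (g : A ⟶ B) (s : G.obj A), Q B ∧ IsPresentation G g s

lemma map_add_apply (G : W ⥤ AddCommGrpCat.{v'}) [G.Additive] {A B : W} (f g : A ⟶ B)
    (s : G.obj A) : G.map (f + g) s = G.map f s + G.map g s := by
  rw [G.map_add]; rfl

lemma map_sub_apply (G : W ⥤ AddCommGrpCat.{v'}) [G.Additive] {A B : W} (f g : A ⟶ B)
    (s : G.obj A) : G.map (f - g) s = G.map f s - G.map g s := by
  rw [G.map_sub]; rfl

/-- A morphism out of a functor generated by `u` may be prescribed on `u`, as long as the relations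
of `u` are respected. -/
lemma exists_hom_of_generates {P G : W ⥤ AddCommGrpCat.{v'}} [P.Additive] [G.Additive] {A : W}
    {u : P.obj A} (hu : ∀ (Z : W) (t : P.obj Z), ∃ c : A ⟶ Z, P.map c u = t) (s : G.obj A)
    (hs : ∀ (Z : W) (c : A ⟶ Z), P.map c u = 0 → G.map c s = 0) :
    ∃ φ : P ⟶ G, φ.app A u = s := by
  choose c hc using hu
  have key : ∀ (Z : W) (a b : A ⟶ Z), P.map a u = P.map b u → G.map a s = G.map b s := by
    intro Z a b h
    rw [← sub_eq_zero, ← map_sub_apply]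
    exact hs Z _ (by rw [map_sub_apply, h, sub_self])
  refine ⟨{ app := fun Z => AddCommGrpCat.ofHom (AddMonoidHom.mk' (fun t => G.map (c Z t) s) ?_),
            naturality := ?_ }, ?_⟩
  · intro t t'
    rw [← map_add_apply]
    exact key Z _ _ (by rw [map_add_apply, hc, hc, hc])
  · intro Z Z' f
    ext t
    change G.map (c Z' (P.map f t)) s = G.map f (G.map (c Z t) s)
    rw [← map_comp_apply']
    exact key Z' _ _ (by rw [map_comp_apply', hc, hc])
  · change G.map (c A u) s = s
    conv_rhs => rw [← map_id_apply' G s]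
    exact key A _ _ (by rw [hc, map_id_apply'])

/-- Two functors whose presentations have the same relations are isomorphic. -/
lemma IsPresentation.nonempty_iso {P G : W ⥤ AddCommGrpCat.{v'}} [P.Additive] [G.Additive]
    {A B B' : W} {g : A ⟶ B} {g' : A ⟶ B'} {u : P.obj A} {s : G.obj A} (hP : IsPresentation P g u)
    (hG : IsPresentation G g' s) {d : B ⟶ B'} {d' : B' ⟶ B} (hd : g ≫ d = g') (hd' : g' ≫ d' = g) :
    Nonempty (P ≅ G) := by
  obtain ⟨φ, hφ⟩ := exists_hom_of_generates hP.generates s fun Z c hc => by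
    obtain ⟨k, rfl⟩ := hP.exists_fac Z c hc
    rw [← hd', Category.assoc, map_comp_apply', hG.map_eq_zero, map_zero]
  obtain ⟨ψ, hψ⟩ := exists_hom_of_generates hG.generates u fun Z c hc => by
    obtain ⟨k, rfl⟩ := hG.exists_fac Z c hc
    rw [← hd, Category.assoc, map_comp_apply', hP.map_eq_zero, map_zero]
  refine ⟨φ, ψ, hom_ext_of_generates hP.generates ?_, hom_ext_of_generates hG.generates ?_⟩
  · change ψ.app A (φ.app A u) = u
    rw [hφ, hψ]
  · change φ.app A (ψ.app A s) = s
    rw [hψ, hφ]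

lemma FinPresented.of_iso {Q : ObjectProperty W} {G G' : W ⥤ AddCommGrpCat.{v'}} (e : G ≅ G')
    (hG : FinPresented Q G) : FinPresented Q G' := by
  obtain ⟨hadd, A, B, g, s, hB, h⟩ := hG
  have hinv : ∀ (Z : W) (t : G'.obj Z), e.hom.app Z (e.inv.app Z t) = t := fun Z t => by
    change (e.inv ≫ e.hom).app Z t = t
    rw [e.inv_hom_id]; rfl
  have hinv' : ∀ (Z : W) (t : G.obj Z), e.inv.app Z (e.hom.app Z t) = t := fun Z t => by
    change (e.hom ≫ e.inv).app Z t = t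
    rw [e.hom_inv_id]; rfl
  refine ⟨Functor.additive_of_iso e, A, B, g, e.hom.app A s, hB, fun Z t => ?_, ?_,
    fun Z c hc => h.exists_fac Z c ?_⟩
  · obtain ⟨c, hc⟩ := h.generates Z (e.inv.app Z t)
    exact ⟨c, by rw [← naturality_apply', hc, hinv]⟩
  · rw [← naturality_apply', h.map_eq_zero, map_zero]
  · rw [← hinv' Z (G.map c s), naturality_apply', hc, map_zero]

section Extensions

variable {S : ShortComplex (W ⥤ AddCommGrpCat.{v'})} (hS : S.ShortExact)
include hS

omit [Preadditive W] in
lemma shortExact_app (Z : W) : (S.map ((evaluation W AddCommGrpCat.{v'}).obj Z)).ShortExact :=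
  hS.map_of_exact _

omit [Preadditive W] in
lemma app_injective (Z : W) (t : S.X₁.obj Z) (ht : S.f.app Z t = 0) : t = 0 :=
  (shortExact_app hS Z).ab_injective_f (ht.trans (map_zero _).symm)

omit [Preadditive W] in
lemma app_surjective (Z : W) (t : S.X₃.obj Z) : ∃ t', S.g.app Z t' = t :=
  (shortExact_app hS Z).ab_surjective_g t

omit [Preadditive W] in
lemma app_exact (Z : W) (t : S.X₂.obj Z) (ht : S.g.app Z t = 0) : ∃ t', S.f.app Z t' = t :=
  (ShortComplex.ab_exact_iff _).1 (shortExact_app hS Z).exact t ht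

omit [Preadditive W] hS in
lemma app_comp_eq_zero (Z : W) (t : S.X₁.obj Z) : S.g.app Z (S.f.app Z t) = 0 :=
  (S.map ((evaluation W AddCommGrpCat.{v'}).obj Z)).ab_zero_apply t

/-- An extension of additive functors is additive. This is needed because the ambient abelian
category consists of all functors, additive or not. -/
lemma additive_of_shortExact (hW : ∀ A : W, ∃ b : BinaryBicone A A,
      b.fst ≫ b.inl + b.snd ≫ b.inr = 𝟙 b.pt) (h₁ : S.X₁.Additive) (h₃ : S.X₃.Additive) :
    S.X₂.Additive := by
  have hzero : ∀ {Y Z : W} (t : S.X₂.obj Y), S.X₂.map (0 : Y ⟶ Z) t = 0 := by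
    intro Y Z t
    obtain ⟨a, ha⟩ := app_exact hS Z (S.X₂.map (0 : Y ⟶ Z) t) (by
      rw [naturality_apply', S.X₃.map_zero]; rfl)
    rw [← comp_zero (f := (0 : Y ⟶ Z)) (Z := Z), map_comp_apply', ← ha, ← naturality_apply',
      S.X₁.map_zero]
    exact map_zero _
  refine ⟨fun {Y Z f g} => ?_⟩
  obtain ⟨b, hb⟩ := hW Y
  -- elements over a biproduct are determined by their components
  have key : ∀ e : S.X₂.obj b.pt, e = S.X₂.map (b.fst ≫ b.inl) e + S.X₂.map (b.snd ≫ b.inr) e := by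
    intro e
    rw [← sub_eq_zero]
    obtain ⟨a, ha⟩ := app_exact hS _ (e - (S.X₂.map (b.fst ≫ b.inl) e +
      S.X₂.map (b.snd ≫ b.inr) e)) (by
        rw [map_sub, map_add, naturality_apply', naturality_apply', ← map_add_apply, hb,
          map_id_apply', sub_self])
    have ha₁ : S.X₁.map b.fst a = 0 := app_injective hS _ _ (by
      rw [naturality_apply', ha, map_sub, map_add, ← map_comp_apply', ← map_comp_apply']
      simp [hzero])
    have ha₂ : S.X₁.map b.snd a = 0 := app_injective hS _ _ (by
      rw [naturality_apply', ha, map_sub, map_add, ← map_comp_apply', ← map_comp_apply']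
      simp [hzero])
    rw [← ha, ← map_id_apply' _ a, ← hb, map_add_apply, map_comp_apply', map_comp_apply', ha₁, ha₂]
    simp
  ext t
  change S.X₂.map (f + g) t = S.X₂.map f t + S.X₂.map g t
  have h := congrArg (S.X₂.map (b.fst ≫ f + b.snd ≫ g)) (key (S.X₂.map (b.inl + b.inr) t))
  rw [map_add] at h
  simpa [← map_comp_apply'] using h

/-- The horseshoe lemma: the generators and the relations of an extension are biproducts of those of
its ends. The entry `-h` of the new relation corrects for the relation `g₃`, which need not hold for
the chosen lift `s` of the generator of `S.X₃`. -/
lemma finPresented_of_shortExact {Q : ObjectProperty W}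
    (hW : ∀ A B : W, ∃ b : BinaryBicone A B,
      b.fst ≫ b.inl + b.snd ≫ b.inr = 𝟙 b.pt ∧ (Q A → Q B → Q b.pt))
    (h₁ : FinPresented Q S.X₁) (h₃ : FinPresented Q S.X₃) : FinPresented Q S.X₂ := by
  obtain ⟨hadd₁, A₁, B₁, g₁, s₁, hB₁, H₁⟩ := h₁
  obtain ⟨hadd₃, A₃, B₃, g₃, s₃, hB₃, H₃⟩ := h₃
  have hadd₂ : S.X₂.Additive :=
    additive_of_shortExact hS (fun A => (hW A A).imp fun _ h => h.1) hadd₁ hadd₃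
  obtain ⟨a, ha, -⟩ := hW A₁ A₃
  obtain ⟨b, hb, hQ⟩ := hW B₁ B₃
  obtain ⟨s, rfl⟩ := app_surjective hS A₃ s₃
  obtain ⟨t, ht⟩ := app_exact hS B₃ (S.X₂.map g₃ s) (by rw [naturality_apply', H₃.map_eq_zero])
  obtain ⟨h, rfl⟩ := H₁.generates _ t
  rw [naturality_apply'] at ht
  refine ⟨hadd₂, a.pt, b.pt, a.fst ≫ (g₁ ≫ b.inl - h ≫ b.inr) + a.snd ≫ g₃ ≫ b.inr,
    S.X₂.map a.inl (S.f.app _ s₁) + S.X₂.map a.inr s, hQ hB₁ hB₃, ?_, ?_, ?_⟩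
  · intro Z z
    obtain ⟨c₃, hc₃⟩ := H₃.generates Z (S.g.app Z z)
    rw [← naturality_apply'] at hc₃
    obtain ⟨y, hy⟩ := app_exact hS Z (z - S.X₂.map c₃ s) (by rw [map_sub, hc₃, sub_self])
    obtain ⟨c₁, rfl⟩ := H₁.generates Z y
    refine ⟨a.fst ≫ c₁ + a.snd ≫ c₃, ?_⟩
    rw [naturality_apply'] at hy
    simp [← map_comp_apply', hy]
  · rw [map_add, ← map_comp_apply', ← map_comp_apply']
    simp only [Preadditive.comp_add, BinaryBicone.inl_fst_assoc, BinaryBicone.inl_snd_assoc,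
      BinaryBicone.inr_fst_assoc, BinaryBicone.inr_snd_assoc, zero_comp, add_zero, zero_add]
    rw [map_sub_apply, map_comp_apply', map_comp_apply', map_comp_apply', ht,
      ← naturality_apply' S.f g₁, H₁.map_eq_zero]
    simp
  · intro Z c hc
    rw [map_add, ← map_comp_apply', ← map_comp_apply'] at hc
    obtain ⟨d₃, hd₃⟩ := H₃.exists_fac Z (a.inr ≫ c) (by
      have := congrArg (S.g.app Z) hc
      rwa [map_add, naturality_apply', naturality_apply', app_comp_eq_zero, map_zero, map_zero,
        zero_add] at this)
    obtain ⟨d₁, hd₁⟩ := H₁.exists_fac Z (a.inl ≫ c + h ≫ d₃) (app_injective hS _ _ (by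
      rw [map_add_apply, map_add, naturality_apply', naturality_apply', map_comp_apply' _ h, ht,
        ← map_comp_apply', hd₃, hc]))
    refine ⟨b.fst ≫ d₁ + b.snd ≫ d₃, ?_⟩
    rw [← Category.id_comp c, ← ha]
    simp [hd₁, hd₃]

end Extensions

/-- A universal element of an additive functor, that is, a representation of it by `A`. -/
structure IsUniversal (P : W ⥤ AddCommGrpCat.{v'}) {A : W} (u : P.obj A) : Prop where
  generates : ∀ (Z : W) (t : P.obj Z), ∃ c : A ⟶ Z, P.map c u = t
  eq_zero : ∀ (Z : W) (c : A ⟶ Z), P.map c u = 0 → c = 0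

section Universal

variable {P P' G : W ⥤ AddCommGrpCat.{v'}} [P.Additive] [P'.Additive] {A B : W} {u : P.obj A}
  {u' : P'.obj B} (hu : IsUniversal P u) (hu' : IsUniversal P' u')

include hu hu'

omit [P'.Additive] in
/-- A presentation of a functor by representable ones in terms of elements. -/
lemma exists_isPresentation [G.Additive] {α : P' ⟶ P} {β : P ⟶ G} {w : α ≫ β = 0}
    (h : (ShortComplex.mk α β w).Exact) (hβ : Epi β) :
    ∃ (g : A ⟶ B) (s : G.obj A), IsPresentation G g s := by
  obtain ⟨g, hg⟩ := hu.generates B (α.app B u')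
  have hepi : ∀ Z, Function.Surjective (β.app Z) := fun Z =>
    (AddCommGrpCat.epi_iff_surjective _).1 inferInstance
  have hex : ∀ Z (t : P.obj Z), β.app Z t = 0 → ∃ t', α.app Z t' = t := fun Z t ht =>
    (ShortComplex.ab_exact_iff _).1 (h.map ((evaluation W AddCommGrpCat.{v'}).obj Z)) t ht
  have hzero : ∀ Z (t : P'.obj Z), β.app Z (α.app Z t) = 0 := fun Z t => by
    change (α ≫ β).app Z t = 0
    rw [w]; rfl
  refine ⟨g, β.app A u, fun Z t => ?_, ?_, fun Z c hc => ?_⟩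
  · obtain ⟨t, rfl⟩ := hepi Z t
    obtain ⟨c, rfl⟩ := hu.generates Z t
    exact ⟨c, (naturality_apply' _ _ _).symm⟩
  · rw [← naturality_apply', hg, hzero]
  · rw [← naturality_apply'] at hc
    obtain ⟨t, ht⟩ := hex Z _ hc
    obtain ⟨d, rfl⟩ := hu'.generates Z t
    rw [naturality_apply', ← hg, ← map_comp_apply'] at ht
    exact ⟨d, sub_eq_zero.1 (hu.eq_zero _ _ (by rw [map_sub_apply, ht, sub_self]))⟩

lemma IsPresentation.exists_exact [G.Additive] {g : A ⟶ B} {s : G.obj A}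
    (h : IsPresentation G g s) :
    ∃ (α : P' ⟶ P) (β : P ⟶ G) (w : α ≫ β = 0), (ShortComplex.mk α β w).Exact ∧ Epi β := by
  obtain ⟨α, hα⟩ := exists_hom_of_generates hu'.generates (P.map g u) fun Z c hc => by
    rw [hu'.eq_zero Z c hc, P.map_zero]; rfl
  obtain ⟨β, hβ⟩ := exists_hom_of_generates hu.generates s fun Z c hc => by
    rw [hu.eq_zero Z c hc, G.map_zero]; rfl
  have w : α ≫ β = 0 := hom_ext_of_generates hu'.generates (by
    change β.app B (α.app B u') = 0
    rw [hα, naturality_apply', hβ, h.map_eq_zero])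
  refine ⟨α, β, w, ?_, ?_⟩
  · rw [ShortComplex.exact_iff_isZero_homology, Functor.isZero_iff]
    intro Z
    refine IsZero.of_iso ?_ ((ShortComplex.mk α β w).mapHomologyIso
      ((evaluation W AddCommGrpCat.{v'}).obj Z)).symm
    rw [← ShortComplex.exact_iff_isZero_homology, ShortComplex.ab_exact_iff]
    intro t ht
    obtain ⟨c, rfl⟩ := hu.generates Z t
    change β.app Z (P.map c u) = 0 at ht
    rw [naturality_apply', hβ] at ht
    obtain ⟨d, rfl⟩ := h.exists_fac Z c ht
    refine ⟨P'.map d u', ?_⟩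
    change α.app Z (P'.map d u') = P.map (g ≫ d) u
    rw [naturality_apply', hα, map_comp_apply']
  · rw [NatTrans.epi_iff_epi_app]
    intro Z
    rw [AddCommGrpCat.epi_iff_surjective]
    intro t
    obtain ⟨c, rfl⟩ := h.generates Z t
    exact ⟨P.map c u, by rw [naturality_apply', hβ]⟩

end Universal

/-! ### Full functors from versal elements -/

/-- `s ∈ H(M)(A)` is versal: each element of some `H(N)(A)` killed by `g` is the image of `s` under
a morphism `M ⟶ N`. -/
def IsVersal {A' : Type u'} [Category.{v'} A'] (H : A' ⥤ W ⥤ AddCommGrpCat.{v}) {M : A'}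
    {A B : W} (g : A ⟶ B) (s : (H.obj M).obj A) : Prop :=
  ∀ (N : A') (t : (H.obj N).obj A), (H.obj N).map g t = 0 →
    ∃ f : M ⟶ N, (H.map f).app A s = t

omit [Preadditive W] in
lemma IsVersal.map_surjective {A' : Type u'} [Category.{v'} A'] {H : A' ⥤ W ⥤ AddCommGrpCat.{v}}
    {M : A'} {A B : W} {g : A ⟶ B} {s : (H.obj M).obj A} (hs : IsVersal H g s)
    (h : IsPresentation (H.obj M) g s) {N : A'} (φ : H.obj M ⟶ H.obj N) :
    ∃ f : M ⟶ N, H.map f = φ := by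
  obtain ⟨f, hf⟩ := hs N (φ.app A s) (by rw [← naturality_apply', h.map_eq_zero, map_zero])
  exact ⟨f, hom_ext_of_generates h.generates hf⟩

end Presentations

section ExactStructures

/-! ### Exact structures induced from abelian categories -/

section Abelian

variable {B : Type u'} [Category.{v'} B] [Abelian B]

lemma shortExact_of_isos {M N L M' N' L' : B} {i : M ⟶ N} {p : N ⟶ L} {w : i ≫ p = 0}
    (h : (ShortComplex.mk i p w).ShortExact) {i' : M' ⟶ N'} {p' : N' ⟶ L'} {w' : i' ≫ p' = 0}
    (e₁ : M ≅ M') (e₂ : N ≅ N') (e₃ : L ≅ L') (h₁ : e₁.hom ≫ i' = i ≫ e₂.hom)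
    (h₂ : e₂.hom ≫ p' = p ≫ e₃.hom) : (ShortComplex.mk i' p' w').ShortExact :=
  ShortComplex.shortExact_of_iso (S₁ := ShortComplex.mk i p w) (ShortComplex.isoMk e₁ e₂ e₃ h₁ h₂) h

/-- The pushout of a short exact sequence along a morphism from its left end. -/
lemma exists_shortExact_of_isPushout {M N L M' Q : B} {i : M ⟶ N} {p : N ⟶ L} {w : i ≫ p = 0}
    (hS : (ShortComplex.mk i p w).ShortExact) {f : M ⟶ M'} {f' : N ⟶ Q} {i' : M' ⟶ Q}
    (h : IsPushout i f f' i') :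
    ∃ (q : Q ⟶ L) (w' : i' ≫ q = 0), f' ≫ q = p ∧ (ShortComplex.mk i' q w').ShortExact := by
  have : Mono i := hS.mono_f
  have : Epi p := hS.epi_g
  have hmono : Mono i' := Abelian.mono_inr_of_isColimit i f h.isColimit
  have hfac := h.inl_desc p 0 (by rw [w, comp_zero])
  have hzero := h.inr_desc p 0 (by rw [w, comp_zero])
  have hepi : Epi (h.desc p 0 (by rw [w, comp_zero])) := epi_of_epi_fac hfac
  refine ⟨h.desc p 0 (by rw [w, comp_zero]), hzero, hfac,
    ShortComplex.ShortExact.mk' (ShortComplex.exact_of_g_is_cokernel _ ?_) hmono hepi⟩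
  refine CokernelCofork.IsColimit.ofπ' _ _ fun k hk => ?_
  have hk' : i ≫ f' ≫ k = 0 := by rw [h.w_assoc, hk, comp_zero]
  refine ⟨hS.gIsCokernel.desc (CokernelCofork.ofπ (f' ≫ k) hk'), h.hom_ext ?_ ?_⟩
  · rw [reassoc_of% hfac]
    exact hS.gIsCokernel.fac (CokernelCofork.ofπ (f' ≫ k) hk') WalkingParallelPair.one
  · rw [reassoc_of% hzero, zero_comp, hk]

/-- The pullback of a short exact sequence along a morphism to its right end. -/
lemma exists_shortExact_of_isPullback {M N L L' Q : B} {i : M ⟶ N} {p : N ⟶ L} {w : i ≫ p = 0}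
    (hS : (ShortComplex.mk i p w).ShortExact) {f : L' ⟶ L} {f' : Q ⟶ N} {p' : Q ⟶ L'}
    (h : IsPullback f' p' p f) :
    ∃ (j : M ⟶ Q) (w' : j ≫ p' = 0), j ≫ f' = i ∧ (ShortComplex.mk j p' w').ShortExact := by
  have : Mono i := hS.mono_f
  have : Epi p := hS.epi_g
  have hepi : Epi p' := Abelian.epi_snd_of_isLimit _ _ h.isLimit
  have hfac := h.lift_fst i 0 (by rw [w, zero_comp])
  have hzero := h.lift_snd i 0 (by rw [w, zero_comp])
  have hmono : Mono (h.lift i 0 (by rw [w, zero_comp])) := mono_of_mono_fac hfac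
  refine ⟨h.lift i 0 (by rw [w, zero_comp]), hzero, hfac,
    ShortComplex.ShortExact.mk' (ShortComplex.exact_of_f_is_kernel _ ?_) hmono hepi⟩
  refine KernelFork.IsLimit.ofι' _ _ fun k hk => ?_
  have hk' : (k ≫ f') ≫ p = 0 := by rw [Category.assoc, h.w, reassoc_of% hk, zero_comp]
  refine ⟨hS.fIsKernel.lift (KernelFork.ofι (k ≫ f') hk'), h.hom_ext ?_ ?_⟩
  · rw [Category.assoc, hfac]
    exact hS.fIsKernel.fac (KernelFork.ofι (k ≫ f') hk') WalkingParallelPair.zero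
  · rw [Category.assoc, hzero, comp_zero, hk]

/-- The composite of the monomorphisms of two short exact sequences, with cokernel a pushout. -/
lemma shortExact_comp_of_isPushout {M N L P Q R : B} {i : M ⟶ N} {p : N ⟶ P} {w : i ≫ p = 0}
    (hS : (ShortComplex.mk i p w).ShortExact) {j : N ⟶ L} {q : L ⟶ R} {w' : j ≫ q = 0}
    (hS' : (ShortComplex.mk j q w').ShortExact) {p' : L ⟶ Q} {j' : P ⟶ Q}
    (h : IsPushout j p p' j') :
    ∃ w'' : (i ≫ j) ≫ p' = 0, (ShortComplex.mk (i ≫ j) p' w'').ShortExact := by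
  have : Mono i := hS.mono_f
  have : Mono j := hS'.mono_f
  have : Epi p := hS.epi_g
  have hw : (i ≫ j) ≫ p' = 0 := by rw [Category.assoc, h.w, reassoc_of% w, zero_comp]
  refine ⟨hw, ShortComplex.ShortExact.mk' (ShortComplex.exact_of_g_is_cokernel _ ?_)
    (mono_comp i j) ⟨fun a b hab => h.hom_ext hab ?_⟩⟩
  · have : Epi p' := ⟨fun a b hab => h.hom_ext hab (by
      rw [← cancel_epi p, ← reassoc_of% h.w, hab, reassoc_of% h.w])⟩
    refine CokernelCofork.IsColimit.ofπ' _ _ fun k hk => ?_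
    have hk' : i ≫ j ≫ k = 0 := by rw [← Category.assoc, hk]
    exact ⟨h.desc k (hS.gIsCokernel.desc (CokernelCofork.ofπ (j ≫ k) hk'))
      (hS.gIsCokernel.fac (CokernelCofork.ofπ (j ≫ k) hk') WalkingParallelPair.one).symm,
      h.inl_desc _ _ _⟩
  · rw [← cancel_epi p, ← reassoc_of% h.w, hab, reassoc_of% h.w]

/-- The composite of the epimorphisms of two short exact sequences, with kernel a pullback. -/
lemma shortExact_comp_of_isPullback {M N L P Q R : B} {j : R ⟶ M} {p : M ⟶ N} {w : j ≫ p = 0}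
    (hS : (ShortComplex.mk j p w).ShortExact) {i : P ⟶ N} {q : N ⟶ L} {w' : i ≫ q = 0}
    (hS' : (ShortComplex.mk i q w').ShortExact) {i' : Q ⟶ M} {p' : Q ⟶ P}
    (h : IsPullback i' p' p i) :
    ∃ w'' : i' ≫ p ≫ q = 0, (ShortComplex.mk i' (p ≫ q) w'').ShortExact := by
  have : Mono i := hS'.mono_f
  have : Epi p := hS.epi_g
  have : Epi q := hS'.epi_g
  have hw : i' ≫ p ≫ q = 0 := by rw [h.w_assoc, w', comp_zero]
  have hm : Mono i' := ⟨fun a b hab => h.hom_ext hab (by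
    rw [← cancel_mono i, Category.assoc, Category.assoc, ← h.w, reassoc_of% hab])⟩
  refine ⟨hw, ShortComplex.ShortExact.mk' (ShortComplex.exact_of_f_is_kernel _ ?_) hm
    (epi_comp p q)⟩
  refine KernelFork.IsLimit.ofι' _ _ fun k hk => ?_
  have hk' : (k ≫ p) ≫ q = 0 := by rw [Category.assoc, hk]
  exact ⟨h.lift k (hS'.fIsKernel.lift (KernelFork.ofι (k ≫ p) hk'))
    (hS'.fIsKernel.fac (KernelFork.ofι (k ≫ p) hk') WalkingParallelPair.zero).symm,
    h.lift_fst _ _ _⟩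

end Abelian

variable {A : Type u} [Category.{v} A] {B : Type u'} [Category.{v'} B] [Abelian B]

lemma admMono_of_shortExact {F : A ⥤ B} [F.Full] {M N : A} {i : M ⟶ N} {Q : B}
    {q : F.obj N ⟶ Q} {w : F.map i ≫ q = 0}
    (h : (ShortComplex.mk (F.map i) q w).ShortExact) (hQ : F.essImage Q) :
    AdmMono (inducedClass F) i := by
  obtain ⟨L, ⟨e⟩⟩ := hQ
  have hp : F.map (F.preimage (q ≫ e.inv)) = q ≫ e.inv := F.map_preimage _
  refine ⟨L, F.preimage (q ≫ e.inv), by rw [hp, reassoc_of% w, zero_comp], ?_⟩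
  exact shortExact_of_isos h (Iso.refl _) (Iso.refl _) e.symm (by simp) (by simp [hp])

lemma admEpi_of_shortExact {F : A ⥤ B} [F.Full] {N L : A} {p : N ⟶ L} {Q : B}
    {j : Q ⟶ F.obj N} {w : j ≫ F.map p = 0}
    (h : (ShortComplex.mk j (F.map p) w).ShortExact) (hQ : F.essImage Q) :
    AdmEpi (inducedClass F) p := by
  obtain ⟨M, ⟨e⟩⟩ := hQ
  have hi : F.map (F.preimage (e.hom ≫ j)) = e.hom ≫ j := F.map_preimage _
  refine ⟨M, F.preimage (e.hom ≫ j), by rw [hi, Category.assoc, w, comp_zero], ?_⟩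
  exact shortExact_of_isos h e.symm (Iso.refl _) (Iso.refl _) (by simp [hi]) (by simp)

variable [Preadditive A] (F : A ⥤ B) [F.Additive] [F.Full] [F.Faithful]

lemma hasBinaryBiproduct_of_essImage (F : A ⥤ B) [F.Additive] [F.Full] [F.Faithful]
    [F.essImage.IsClosedUnderExtensions] (M N : A) : HasBinaryBiproduct M N := by
  obtain ⟨P, ⟨e⟩⟩ := F.essImage.prop_biprod (F.obj_mem_essImage M) (F.obj_mem_essImage N)
  refine hasBinaryBiproduct_of_total (C := A)
    { pt := P
      fst := F.preimage (e.hom ≫ biprod.fst)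
      snd := F.preimage (e.hom ≫ biprod.snd)
      inl := F.preimage (biprod.inl ≫ e.inv)
      inr := F.preimage (biprod.inr ≫ e.inv)
      inl_fst := F.map_injective (by simp)
      inl_snd := F.map_injective (by simp)
      inr_fst := F.map_injective (by simp)
      inr_snd := F.map_injective (by simp) } (F.map_injective ?_)
  simp only [F.map_add, F.map_comp, F.map_preimage, F.map_id, Category.assoc]
  have h : e.hom ≫ (biprod.fst ≫ biprod.inl + biprod.snd ≫ biprod.inr) ≫ e.inv = 𝟙 _ := by
    rw [biprod.total]; simp
  simpa only [Preadditive.add_comp, Preadditive.comp_add, Category.assoc] using h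

/-- A full additive subcategory of an abelian category which is closed under extensions is an exact
category: the pushouts, pullbacks and composites formed in the ambient category stay inside. -/
lemma isExactCategory_inducedClass [F.essImage.IsClosedUnderExtensions] {Z : A} (hZ : IsZero Z) :
    IsExactCategory (inducedClass F) where
  additive := by
    have : HasBinaryBiproducts A := ⟨hasBinaryBiproduct_of_essImage F⟩
    have : HasZeroObject A := ⟨⟨Z, hZ⟩⟩
    have : HasFiniteProducts A := hasFiniteProducts_of_has_binary_and_terminal
    exact HasFiniteBiproducts.of_hasFiniteProducts
  kernel_cokernel := by
    rintro M N L i p ⟨w, h⟩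
    have : Mono (F.map i) := h.mono_f
    have : Epi (F.map p) := h.epi_g
    have : Mono i := F.mono_of_mono_map ‹_›
    have : Epi p := F.epi_of_epi_map ‹_›
    have w' : i ≫ p = 0 := F.map_injective (by rw [F.map_comp, w, F.map_zero])
    refine ⟨w', ⟨KernelFork.IsLimit.ofι' _ _ fun k hk => ?_⟩,
      ⟨CokernelCofork.IsColimit.ofπ' _ _ fun k hk => ?_⟩⟩
    · have hk' : F.map k ≫ F.map p = 0 := by rw [← F.map_comp, hk, F.map_zero]
      refine ⟨F.preimage (h.fIsKernel.lift (KernelFork.ofι _ hk')), F.map_injective ?_⟩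
      rw [F.map_comp, F.map_preimage]
      exact h.fIsKernel.fac (KernelFork.ofι _ hk') WalkingParallelPair.zero
    · have hk' : F.map i ≫ F.map k = 0 := by rw [← F.map_comp, hk, F.map_zero]
      refine ⟨F.preimage (h.gIsCokernel.desc (CokernelCofork.ofπ _ hk')), F.map_injective ?_⟩
      rw [F.map_comp, F.map_preimage]
      exact h.gIsCokernel.fac (CokernelCofork.ofπ _ hk') WalkingParallelPair.one
  iso_closed := by
    rintro M N L M' N' L' i p i' p' e₁ e₂ e₃ h₁ h₂ ⟨w, h⟩
    have hi : i' = e₁.inv ≫ i ≫ e₂.hom := by rw [h₁, e₁.inv_hom_id_assoc]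
    have hp : p' = e₂.inv ≫ p ≫ e₃.hom := by rw [h₂, e₂.inv_hom_id_assoc]
    have w' : F.map i' ≫ F.map p' = 0 := by
      rw [hi, hp, ← F.map_comp]
      simp [reassoc_of% w]
    refine ⟨w', shortExact_of_isos h (F.mapIso e₁) (F.mapIso e₂) (F.mapIso e₃) ?_ ?_⟩
    · simp [hi]
    · simp [hp]
  id_admMono M := by
    have hs : (ShortComplex.mk (𝟙 M) (0 : M ⟶ Z) comp_zero).Splitting :=
      { r := 𝟙 M, s := 0, s_g := hZ.eq_of_src _ _ }
    exact ⟨Z, 0, _, (hs.map F).shortExact⟩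
  id_admEpi M := by
    have hs : (ShortComplex.mk (0 : Z ⟶ M) (𝟙 M) zero_comp).Splitting :=
      { r := 0, s := 𝟙 M, f_r := hZ.eq_of_src _ _ }
    exact ⟨Z, 0, _, (hs.map F).shortExact⟩
  comp_admMono := by
    rintro M N L i j ⟨P, p, w, h⟩ ⟨R, q, w', h'⟩
    have hpo := IsPushout.of_hasPushout (F.map j) (F.map p)
    obtain ⟨_, hw₁, -, h₁⟩ := exists_shortExact_of_isPushout h' hpo
    obtain ⟨hw₂, h₂⟩ := shortExact_comp_of_isPushout h h' hpo
    rw [← F.map_comp] at hw₂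
    refine admMono_of_shortExact (w := hw₂) ?_ (F.essImage.prop_X₂_of_shortExact h₁
      (F.obj_mem_essImage P) (F.obj_mem_essImage R))
    simpa only [F.map_comp] using h₂
  comp_admEpi := by
    rintro M N L p q ⟨R, j, w, h⟩ ⟨P, i, w', h'⟩
    have hpb := IsPullback.of_hasPullback (F.map p) (F.map i)
    obtain ⟨_, hw₁, -, h₁⟩ := exists_shortExact_of_isPullback h hpb
    obtain ⟨hw₂, h₂⟩ := shortExact_comp_of_isPullback h h' hpb
    rw [← F.map_comp] at hw₂
    refine admEpi_of_shortExact (w := hw₂) ?_ (F.essImage.prop_X₂_of_shortExact h₁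
      (F.obj_mem_essImage R) (F.obj_mem_essImage P))
    simpa only [F.map_comp] using h₂
  pushout := by
    rintro M N M' i f ⟨L, p, w, h⟩
    have hpo := IsPushout.of_hasPushout (F.map i) (F.map f)
    obtain ⟨q, hw, -, hq⟩ := exists_shortExact_of_isPushout h hpo
    obtain ⟨N', ⟨e⟩⟩ := F.essImage.prop_X₂_of_shortExact hq (F.obj_mem_essImage M')
      (F.obj_mem_essImage L)
    have hi : F.map (F.preimage (pushout.inr (F.map i) (F.map f) ≫ e.inv)) = _ := F.map_preimage _
    refine ⟨N', F.preimage (pushout.inl _ _ ≫ e.inv), F.preimage (pushout.inr _ _ ≫ e.inv),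
      IsPushout.of_map F (F.map_injective ?_) ?_, admMono_of_shortExact (q := e.hom ≫ q)
        (w := by rw [hi]; simpa using hw) ?_ (F.obj_mem_essImage L)⟩
    · simp [pushout.condition_assoc]
    · exact hpo.of_iso (Iso.refl _) (Iso.refl _) (Iso.refl _) e.symm (by simp) (by simp) (by simp)
        (by simp)
    · exact shortExact_of_isos hq (Iso.refl _) e.symm (Iso.refl _) (by simp [hi]) (by simp)
  pullback := by
    rintro N L L' p f ⟨M, i, w, h⟩
    have hpb := IsPullback.of_hasPullback (F.map p) (F.map f)
    obtain ⟨j, hw, -, hj⟩ := exists_shortExact_of_isPullback h hpb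
    obtain ⟨N', ⟨e⟩⟩ := F.essImage.prop_X₂_of_shortExact hj (F.obj_mem_essImage M)
      (F.obj_mem_essImage L')
    have hp : F.map (F.preimage (e.hom ≫ pullback.snd (F.map p) (F.map f))) = _ := F.map_preimage _
    refine ⟨N', F.preimage (e.hom ≫ pullback.fst _ _), F.preimage (e.hom ≫ pullback.snd _ _),
      IsPullback.of_map F (F.map_injective ?_) ?_, admEpi_of_shortExact (j := j ≫ e.inv)
        (w := by rw [hp]; simpa using hw) ?_ (F.obj_mem_essImage M)⟩
    · simp [pullback.condition]
    · exact hpb.of_iso e.symm (Iso.refl _) (Iso.refl _) (Iso.refl _) (by simp) (by simp) (by simp)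
        (by simp)
    · exact shortExact_of_isos hj (Iso.refl _) e.symm (Iso.refl _) (by simp) (by simp [hp])

/-- The contravariant version, obtained by passing to the opposite of the abelian category. -/
lemma isExactCategory_inducedClassOp (K : Aᵒᵖ ⥤ B) [K.Additive] [K.Full] [K.Faithful]
    [K.essImage.IsClosedUnderExtensions] {Z : A} (hZ : IsZero Z) :
    IsExactCategory (inducedClassOp K) := by
  have hop : ∀ Y, K.rightOp.essImage Y ↔ K.essImage Y.unop := fun Y =>
    ⟨fun ⟨M, ⟨e⟩⟩ => ⟨op M, ⟨e.unop.symm⟩⟩, fun ⟨M, ⟨e⟩⟩ => ⟨M.unop, ⟨e.symm.op⟩⟩⟩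
  have : K.rightOp.Additive :=
    { map_add := fun {M N f g} => congrArg Quiver.Hom.op (K.map_add (f := f.op) (g := g.op)) }
  have : K.rightOp.essImage.IsClosedUnderExtensions :=
    { prop_X₂_of_shortExact := fun {S} hS h₁ h₃ => by
        rw [hop] at h₁ h₃ ⊢
        exact K.essImage.prop_X₂_of_shortExact hS.unop h₃ h₁ }
  have heq : inducedClass K.rightOp = inducedClassOp K := by
    ext M N L i p
    constructor
    · rintro ⟨w, h⟩
      exact ⟨Quiver.Hom.op_inj w, h.unop⟩
    · rintro ⟨w, h⟩
      exact ⟨congrArg Quiver.Hom.op w, h.op⟩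
  rw [← heq]
  exact isExactCategory_inducedClass K.rightOp hZ

end ExactStructures

/-! ### Krull–Schmidt quotients -/

section KrullSchmidt

variable {A : Type u} [Category.{v} A] [Preadditive A]

instance (I : HomIdeal A) : I.proj.Additive :=
  CategoryTheory.Quotient.functor_additive I.rel _

lemma HomIdeal.proj_map_eq_zero_iff (I : HomIdeal A) {M N : A} (f : M ⟶ N) :
    I.proj.map f = 0 ↔ f ∈ I.carrier M N := by
  rw [← I.proj.map_zero, CategoryTheory.Quotient.functor_map_eq_iff]
  change f - 0 ∈ _ ↔ _
  rw [sub_zero]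

/-- A nonzero quotient of a local ring is local, so that the indecomposable summands of an object
become zero or stay local in the quotient category. -/
lemma isLocalRing_end_quot (I : HomIdeal A) (Y : A) (hY : IsLocalRing (End Y))
    (h : ¬ IsZero (I.proj.obj Y)) : IsLocalRing (End (I.proj.obj Y)) where
  exists_pair_ne := ⟨𝟙 _, 0, fun h' => h ((IsZero.iff_id_eq_zero _).2 h')⟩
  isUnit_or_isUnit_of_add_one {a b} hab := by
    obtain ⟨a, rfl⟩ := I.proj.map_surjective a
    have hb : b = I.proj.map (𝟙 Y - a) := by
      rw [I.proj.map_sub, I.proj.map_id]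
      exact eq_sub_of_add_eq' hab
    have hmap : ∀ c : End Y, IsUnit c → IsUnit (M := End (I.proj.obj Y)) (I.proj.map c) :=
      fun c hc => hc.map (I.proj.mapEnd Y)
    rw [hb]
    exact (hY.isUnit_or_isUnit_of_add_one (a := a) (b := 𝟙 Y - a) (by
      change a + (𝟙 Y - a) = 𝟙 Y
      abel)).imp (hmap a) (hmap _)

lemma KrullSchmidt.quot (hA : KrullSchmidt A) (I : HomIdeal A) : KrullSchmidt I.Quot := by
  classical
  intro M
  obtain ⟨M, rfl⟩ : ∃ M', I.proj.obj M' = M := ⟨M.as, rfl⟩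
  obtain ⟨m, Y, ι, ⟨hc⟩, hY⟩ := hA M
  -- the projections of the decomposition
  let π : ∀ j, M ⟶ Y j := fun j =>
    Cofan.IsColimit.desc hc fun k => if h : k = j then eqToHom (by rw [h]) else 0
  have hπ : ∀ j k, ι k ≫ π j = if h : k = j then eqToHom (by rw [h]) else 0 := fun j k =>
    Cofan.IsColimit.fac hc _ k
  have htot : ∑ j, π j ≫ ι j = 𝟙 M := by
    refine Cofan.IsColimit.hom_ext hc _ _ fun k => ?_
    change ι k ≫ _ = ι k ≫ _
    rw [Preadditive.comp_sum, Category.comp_id, Finset.sum_eq_single k]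
    · rw [← Category.assoc, hπ]; simp
    · intro j _ hj
      rw [← Category.assoc, hπ, dif_neg (Ne.symm hj), zero_comp]
    · simp
  -- keep the summands which stay nonzero
  let S := {j // ¬ IsZero (I.proj.obj (Y j))}
  let e : Fin (Fintype.card S) ≃ S := (Fintype.equivFin S).symm
  have htot' : ∑ s : Fin (Fintype.card S), I.proj.map (π (e s).1) ≫ I.proj.map (ι (e s).1) =
      𝟙 (I.proj.obj M) := by
    rw [← I.proj.map_id, ← htot, I.proj.map_sum,
      Equiv.sum_comp e (fun s : S => I.proj.map (π s.1) ≫ I.proj.map (ι s.1)),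
      ← Finset.sum_subtype (Finset.univ.filter fun j => ¬ IsZero (I.proj.obj (Y j))) (by simp)
        (fun j => I.proj.map (π j) ≫ I.proj.map (ι j)),
      Finset.sum_filter_of_ne]
    · simp
    · exact fun j _ hj h => hj (by rw [h.eq_of_tgt (I.proj.map (π j)) 0, zero_comp])
  refine ⟨Fintype.card S, fun s => I.proj.obj (Y (e s).1), fun s => I.proj.map (ι (e s).1),
    ⟨Cofan.IsColimit.mk _ (fun t => ∑ s, I.proj.map (π (e s).1) ≫ t.inj s) ?_ ?_⟩,
    fun s => isLocalRing_end_quot I _ (hY _) (e s).2⟩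
  · intro t s
    change I.proj.map _ ≫ _ = _
    rw [Preadditive.comp_sum, Finset.sum_eq_single s]
    · rw [← Category.assoc, ← I.proj.map_comp, hπ]; simp
    · intro k _ hk
      rw [← Category.assoc, ← I.proj.map_comp, hπ, dif_neg, I.proj.map_zero, zero_comp]
      exact fun h => hk (e.injective (Subtype.ext h.symm))
    · simp
  · intro t f hf
    rw [← Category.id_comp f]
    change 𝟙 (I.proj.obj M) ≫ f = _
    rw [← htot', Preadditive.sum_comp]
    refine Finset.sum_congr rfl fun s _ => ?_
    rw [Category.assoc]
    exact congrArg _ (hf s)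

end KrullSchmidt

/-! ### Presentations of `𝔼(-, M)` and `𝔼(M, -)` -/

section FullSubcategories

variable {A : Type u} [Category.{v} A] {B : Type u'} [Category.{v'} B] (F : A ⥤ B)
  {P : ObjectProperty B}

lemma essImage_eq (hP : ∀ M, P (F.obj M)) (hiso : ∀ Y Y', (Y ≅ Y') → P Y → P Y')
    (hsurj : ∀ Y, P Y → ∃ M, Nonempty (F.obj M ≅ Y)) : F.essImage = P := by
  ext Y
  exact ⟨fun ⟨M, ⟨e⟩⟩ => hiso _ _ e (hP M), fun h => hsurj Y h⟩

lemma isEquivalence_lift [F.Full] [F.Faithful] (hP : ∀ M, P (F.obj M))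
    (hsurj : ∀ Y, P Y → ∃ M, Nonempty (F.obj M ≅ Y)) : (P.lift F hP).IsEquivalence where
  essSurj := ⟨fun Y => by
    obtain ⟨M, ⟨e⟩⟩ := hsurj Y.obj Y.property
    exact ⟨M, ⟨P.isoMk e⟩⟩⟩

end FullSubcategories

namespace Extriangulation

variable {C : Type u} [Category.{v} C] [Preadditive C] [HasZeroObject C] [HasBinaryBiproducts C]
  {T : Extriangulation C}

omit [HasZeroObject C] in
/-- The biproduct of a full subcategory closed under biproducts, as a bicone in a quotient of it. -/
lemma exists_bicone_quot {S X : ObjectProperty C} (hS : ∀ M N, S M → S N → S (M ⊞ N))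
    (hX : ∀ M N, X M → X N → X (M ⊞ N)) (I : HomIdeal S.FullSubcategory) (M N : I.Quot) :
    ∃ b : BinaryBicone M N, b.fst ≫ b.inl + b.snd ≫ b.inr = 𝟙 b.pt ∧
      (X M.as.obj → X N.as.obj → X b.pt.as.obj) := by
  let b : BinaryBicone M.as N.as :=
    { pt := ⟨M.as.obj ⊞ N.as.obj, hS _ _ M.as.property N.as.property⟩
      fst := ObjectProperty.homMk biprod.fst
      snd := ObjectProperty.homMk biprod.snd
      inl := ObjectProperty.homMk biprod.inl
      inr := ObjectProperty.homMk biprod.inr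
      inl_fst := by ext; exact biprod.inl_fst
      inl_snd := by ext; exact biprod.inl_snd
      inr_fst := by ext; exact biprod.inr_fst
      inr_snd := by ext; exact biprod.inr_snd }
  refine ⟨I.proj.mapBinaryBicone b, ?_, fun hM hN => hX _ _ hM hN⟩
  have hb : b.fst ≫ b.inl + b.snd ≫ b.inr = 𝟙 b.pt := by
    exact ObjectProperty.hom_ext _ (biprod.total (X := M.as.obj) (Y := N.as.obj))
  have h := congrArg (fun k => I.proj.map k) hb
  simp only [I.proj.map_add, I.proj.map_comp, I.proj.map_id] at h
  exact h

lemma vee_biprod {hI : T.EnoughEInj} {n : ℕ} {X : ObjectProperty C}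
    (hX : T.IsClusterTilting hI n X) (M N : C) (hM : T.vee X n M) (hN : T.vee X n N) :
    T.vee X n (M ⊞ N) := by
  rw [hX.vee_iff] at hM hN ⊢
  intro X' hX'
  have := hM X' hX'
  have := hN X' hX'
  refine subsingleton_of_forall_eq 0 fun δ => ?_
  rw [← T.pull_id δ, ← biprod.total, T.pull_add_left, T.pull_comp, T.pull_comp,
    Subsingleton.elim (T.pull biprod.inl δ) 0, Subsingleton.elim (T.pull biprod.inr δ) 0,
    T.pull_zero, T.pull_zero, add_zero]

lemma wedge_biprod {hI : T.EnoughEInj} {n : ℕ} {X : ObjectProperty C}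
    (hX : T.IsClusterTilting hI n X) (hP : T.EnoughEProj) (M N : C) (hM : T.wedge X n M)
    (hN : T.wedge X n N) : T.wedge X n (M ⊞ N) := by
  rw [hX.wedge_iff hP] at hM hN ⊢
  intro X' hX'
  have := hM X' hX'
  have := hN X' hX'
  refine subsingleton_of_forall_eq 0 fun δ => ?_
  rw [← T.push_id δ, ← biprod.total, T.push_add_left, T.push_comp, T.push_comp,
    Subsingleton.elim (T.push biprod.fst δ) 0, Subsingleton.elim (T.push biprod.snd δ) 0,
    T.push_zero, T.push_zero, add_zero]

instance additive_functorH_obj (X : ObjectProperty C) (n : ℕ) (M : C) :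
    ((T.functorH X n).obj M).Additive where
  map_add {Y Z f g} := by
    obtain ⟨f, rfl⟩ : ∃ k, Quiver.Hom.op k = f := ⟨f.unop, rfl⟩
    obtain ⟨g, rfl⟩ : ∃ k, Quiver.Hom.op k = g := ⟨g.unop, rfl⟩
    obtain ⟨f, rfl⟩ := (T.projIdeal (T.vee X n)).proj.map_surjective f
    obtain ⟨g, rfl⟩ := (T.projIdeal (T.vee X n)).proj.map_surjective g
    ext δ
    exact T.pull_add_left f.hom g.hom δ

instance additive_functorG_obj (X : ObjectProperty C) (n : ℕ) (M : Cᵒᵖ) :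
    ((T.functorG X n).obj M).Additive where
  map_add {Y Z f g} := by
    obtain ⟨f, rfl⟩ := (T.injIdeal (T.wedge X n)).proj.map_surjective f
    obtain ⟨g, rfl⟩ := (T.injIdeal (T.wedge X n)).proj.map_surjective g
    ext δ
    exact T.push_add_left f.hom g.hom δ

section Modules

variable (T) (X : ObjectProperty C) (n : ℕ)

/-- The objects of `(X_n^∨ / P₁)ᵒᵖ` which lie in `X`. -/
def stableObj : ObjectProperty (T.Stable X n)ᵒᵖ := fun A => X A.unop.as.obj

/-- The objects of `X_n^∧ / I₁` which lie in `X`. -/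
def costableObj : ObjectProperty (T.Costable X n) := fun A => X A.as.obj

lemma isUniversal_yoneda (A : T.Stable X n) :
    IsUniversal (A := op A) (preadditiveYoneda.obj A) (𝟙 A : A ⟶ A) where
  generates Z t := ⟨Quiver.Hom.op t, Category.comp_id (show Z.unop ⟶ A from t)⟩
  eq_zero _ c hc := Quiver.Hom.unop_inj ((Category.comp_id c.unop).symm.trans hc)

lemma isUniversal_coyoneda (A : T.Costable X n) :
    IsUniversal (A := A) (preadditiveCoyoneda.obj (op A)) (𝟙 A : A ⟶ A) where
  generates Z t := ⟨t, Category.id_comp (show A ⟶ Z from t)⟩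
  eq_zero _ c hc := (Category.id_comp c).symm.trans hc

lemma catR_eq : T.catR X n = FinPresented (T.stableObj X n) := by
  ext G
  constructor
  · rintro ⟨hadd, X₀, X₁, hX₀, α, β, w, hex, hβ⟩
    obtain ⟨g, s, h⟩ := exists_isPresentation (T.isUniversal_yoneda X n _)
      (T.isUniversal_yoneda X n _) hex hβ
    exact ⟨hadd, _, _, g, s, hX₀, h⟩
  · rintro ⟨hadd, A, B, g, s, hB, h⟩
    obtain ⟨α, β, w, hex, hβ⟩ := h.exists_exact (T.isUniversal_yoneda X n A.unop)
      (T.isUniversal_yoneda X n B.unop)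
    exact ⟨hadd, B.unop.as, A.unop.as, hB, α, β, w, hex, hβ⟩

lemma catL_eq : T.catL X n = FinPresented (T.costableObj X n) := by
  ext G
  constructor
  · rintro ⟨hadd, X₀, X₁, hX₀, α, β, w, hex, hβ⟩
    obtain ⟨g, s, h⟩ := exists_isPresentation (T.isUniversal_coyoneda X n _)
      (T.isUniversal_coyoneda X n _) hex hβ
    exact ⟨hadd, _, _, g, s, hX₀, h⟩
  · rintro ⟨hadd, A, B, g, s, hB, h⟩
    obtain ⟨α, β, w, hex, hβ⟩ := h.exists_exact (T.isUniversal_coyoneda X n A)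
      (T.isUniversal_coyoneda X n B)
    exact ⟨hadd, B.as, A.as, hB, α, β, w, hex, hβ⟩

end Modules

namespace IsClusterTilting

variable {hI : T.EnoughEInj} {n : ℕ} {X : ObjectProperty C}

lemma le_vee (hX : T.IsClusterTilting hI n X) {M : C} (hM : X M) : T.vee X n M :=
  (hX.vee_iff M).2 fun _ hX' => hX.subsingleton_ext hM hX'

lemma le_wedge (hX : T.IsClusterTilting hI n X) (hP : T.EnoughEProj) {M : C} (hM : X M) :
    T.wedge X n M :=
  (hX.wedge_iff hP M).2 fun _ hX' => hX.subsingleton_ext hX' hM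

lemma isClosedUnderExtensions_catR (hX : T.IsClusterTilting hI n X) :
    (T.catR X n).IsClosedUnderExtensions := by
  rw [catR_eq]
  refine ⟨fun {S} hS h₁ h₃ => finPresented_of_shortExact hS (fun A B => ?_) h₁ h₃⟩
  obtain ⟨b, hb, hb'⟩ := exists_bicone_quot (vee_biprod hX) hX.closedUnderSums.biprod
    (T.projIdeal (T.vee X n)) A.unop B.unop
  refine ⟨b.op, ?_, hb'⟩
  exact congrArg Quiver.Hom.op hb

lemma isClosedUnderExtensions_catL (hX : T.IsClusterTilting hI n X) (hP : T.EnoughEProj) :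
    (T.catL X n).IsClosedUnderExtensions := by
  rw [catL_eq]
  exact ⟨fun {S} hS h₁ h₃ => finPresented_of_shortExact hS
    (exists_bicone_quot (wedge_biprod hX hP) hX.closedUnderSums.biprod _) h₁ h₃⟩

section

variable (hX : T.IsClusterTilting hI n X)
include hX

/-- A conflation `M ⟶ X₀ ⟶ L` with `X₀ ∈ X` and `L ∈ X_n^∨` presents the functor `𝔼(-, M)` on
`X_n^∨`, because `𝔼(-, X₀)` vanishes there. -/
lemma isPresentation_functorH {M X₀ L : C} {x : M ⟶ X₀} {y : X₀ ⟶ L} {δ : T.Ext L M}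
    (h : T.Realizes x y δ) (hX₀ : X X₀) (hL : T.vee X n L) :
    IsPresentation (A := op ((T.projIdeal (T.vee X n)).proj.obj ⟨L, hL⟩))
      (B := op ((T.projIdeal (T.vee X n)).proj.obj ⟨X₀, hX.le_vee hX₀⟩))
      ((T.functorH X n).obj M)
      ((T.projIdeal (T.vee X n)).proj.map (ObjectProperty.homMk y)).op δ where
  generates Z t := by
    have := (hX.vee_iff _).1 Z.unop.as.property X₀ hX₀
    obtain ⟨c, hc⟩ := exists_pull_eq (Z := Z.unop.as.obj) h t (Subsingleton.elim _ _)
    exact ⟨((T.projIdeal (T.vee X n)).proj.map (X := Z.unop.as) (Y := ⟨L, hL⟩)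
      (ObjectProperty.homMk c)).op, hc⟩
  map_eq_zero := pull_defl h
  exists_fac Z c hc := by
    obtain ⟨c, rfl⟩ : ∃ k, Quiver.Hom.op k = c := ⟨c.unop, rfl⟩
    obtain ⟨c, rfl⟩ := (T.projIdeal (T.vee X n)).proj.map_surjective (X := Z.unop.as) c
    obtain ⟨d, hd⟩ := (pull_eq_zero_iff h c.hom).1 hc
    refine ⟨((T.projIdeal (T.vee X n)).proj.map (X := Z.unop.as)
      (Y := ⟨X₀, hX.le_vee hX₀⟩) (ObjectProperty.homMk d)).op, ?_⟩
    rw [← op_comp, ← Functor.map_comp]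
    congr 2
    ext
    exact hd

lemma isVersal_functorH {M X₀ L : C} {x : M ⟶ X₀} {y : X₀ ⟶ L} {δ : T.Ext L M}
    (h : T.Realizes x y δ) (hX₀ : X X₀) (hL : T.vee X n L) :
    IsVersal (A := op ((T.projIdeal (T.vee X n)).proj.obj ⟨L, hL⟩))
      (B := op ((T.projIdeal (T.vee X n)).proj.obj ⟨X₀, hX.le_vee hX₀⟩))
      (T.functorH X n)
      ((T.projIdeal (T.vee X n)).proj.map (ObjectProperty.homMk y)).op δ :=
  fun _ t ht => exists_push_eq h t ht

lemma mem_ideal_iff_functorH {M N : C} (f : M ⟶ N) :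
    f ∈ hX.ideal.carrier M N ↔ (T.functorH X n).map f = 0 := by
  constructor
  · rintro ⟨X₀, hX₀, g, h, rfl⟩
    ext Z δ
    have := (hX.vee_iff _).1 Z.unop.as.property X₀ hX₀
    suffices ∀ δ : T.Ext Z.unop.as.obj M, T.push (g ≫ h) δ = 0 from this δ
    intro δ
    rw [T.push_comp, Subsingleton.elim (T.push g δ) 0, T.push_zero]
  · intro hf
    obtain ⟨X₀, L, x, y, ⟨δ, h⟩, hX₀, hL⟩ := hX.exists_conflation_left M
    obtain ⟨g, hg⟩ := (push_eq_zero_iff h f).1 (congrArg (fun k : (T.functorH X n).obj M ⟶ _ =>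
      k.app (op ((T.projIdeal (T.vee X n)).proj.obj ⟨L, (hX.vee_iff L).2 hL⟩)) δ) hf)
    exact ⟨X₀, hX₀, x, g, hg⟩

variable (hP : T.EnoughEProj)
include hP

/-- A conflation `L ⟶ X₀ ⟶ M` with `X₀ ∈ X` and `L ∈ X_n^∧` presents the functor `𝔼(M, -)` on
`X_n^∧`, because `𝔼(X₀, -)` vanishes there. -/
lemma isPresentation_functorG {L X₀ M : C} {x : L ⟶ X₀} {y : X₀ ⟶ M} {δ : T.Ext M L}
    (h : T.Realizes x y δ) (hX₀ : X X₀) (hL : T.wedge X n L) :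
    IsPresentation (A := (T.injIdeal (T.wedge X n)).proj.obj ⟨L, hL⟩)
      (B := (T.injIdeal (T.wedge X n)).proj.obj ⟨X₀, hX.le_wedge hP hX₀⟩)
      ((T.functorG X n).obj (op M))
      ((T.injIdeal (T.wedge X n)).proj.map (ObjectProperty.homMk x)) δ where
  generates Z t := by
    have := (hX.wedge_iff hP _).1 Z.as.property X₀ hX₀
    obtain ⟨c, hc⟩ := exists_push_eq (N := Z.as.obj) h t (Subsingleton.elim _ _)
    exact ⟨(T.injIdeal (T.wedge X n)).proj.map (X := ⟨L, hL⟩) (Y := Z.as)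
      (ObjectProperty.homMk c), hc⟩
  map_eq_zero := push_inf h
  exists_fac Z c hc := by
    obtain ⟨c, rfl⟩ := (T.injIdeal (T.wedge X n)).proj.map_surjective (Y := Z.as) c
    obtain ⟨d, hd⟩ := (push_eq_zero_iff h c.hom).1 hc
    refine ⟨(T.injIdeal (T.wedge X n)).proj.map (X := ⟨X₀, hX.le_wedge hP hX₀⟩) (Y := Z.as)
      (ObjectProperty.homMk d), ?_⟩
    rw [← Functor.map_comp]
    congr 1
    ext
    exact hd

lemma isVersal_functorG {L X₀ M : C} {x : L ⟶ X₀} {y : X₀ ⟶ M} {δ : T.Ext M L}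
    (h : T.Realizes x y δ) (hX₀ : X X₀) (hL : T.wedge X n L) :
    IsVersal (M := op M) (A := (T.injIdeal (T.wedge X n)).proj.obj ⟨L, hL⟩)
      (B := (T.injIdeal (T.wedge X n)).proj.obj ⟨X₀, hX.le_wedge hP hX₀⟩)
      (T.functorG X n)
      ((T.injIdeal (T.wedge X n)).proj.map (ObjectProperty.homMk x)) δ := fun _ t ht => by
  obtain ⟨f, hf⟩ := exists_pull_eq h t ht
  exact ⟨f.op, hf⟩

lemma mem_ideal_iff_functorG {M N : C} (f : M ⟶ N) :
    f ∈ hX.ideal.carrier M N ↔ (T.functorG X n).map f.op = 0 := by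
  constructor
  · rintro ⟨X₀, hX₀, g, h, rfl⟩
    ext Z δ
    have := (hX.wedge_iff hP _).1 Z.as.property X₀ hX₀
    suffices ∀ δ : T.Ext N Z.as.obj, T.pull (g ≫ h) δ = 0 from this δ
    intro δ
    rw [T.pull_comp, Subsingleton.elim (T.pull h δ) 0, T.pull_zero]
  · intro hf
    obtain ⟨L, X₀, x, y, ⟨δ, h⟩, hX₀, hL⟩ := hX.exists_conflation_right N
    obtain ⟨g, hg⟩ := (pull_eq_zero_iff h f).1 (congrArg
      (fun k : (T.functorG X n).obj (op N) ⟶ _ =>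
        k.app ((T.injIdeal (T.wedge X n)).proj.obj ⟨L, (hX.wedge_iff hP L).2 hL⟩) δ) hf)
    exact ⟨X₀, hX₀, g, y, hg⟩

/-- A presentation by a morphism `f : X₀ ⟶ X₁` is, in the stable category, one by a deflation
`X₀ ⊞ P ⟶ X₁` with `P` projective; the kernel of the deflation is the required object. -/
lemma exists_iso_functorH (G : (T.Stable X n)ᵒᵖ ⥤ AddCommGrpCat.{v}) (hG : T.catR X n G) :
    ∃ M : C, Nonempty ((T.functorH X n).obj M ≅ G) := by
  rw [catR_eq] at hG
  obtain ⟨hadd, A, B, g, s, hB, h⟩ := hG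
  obtain ⟨f, rfl⟩ : ∃ k, Quiver.Hom.op k = g := ⟨g.unop, rfl⟩
  obtain ⟨f, rfl⟩ := (T.projIdeal (T.vee X n)).proj.map_surjective (X := B.unop.as)
    (Y := A.unop.as) f
  obtain ⟨K, P, k, p, hPP, hp⟩ := hP A.unop.as.obj
  obtain ⟨M, l, δ, hδ⟩ := conflation_desc f.hom hp
  have hQ : X (B.unop.as.obj ⊞ P) := hX.closedUnderSums.biprod _ _ hB (hX.of_proj hPP)
  refine ⟨M, (hX.isPresentation_functorH hδ hQ A.unop.as.property).nonempty_iso h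
    (d := ((T.projIdeal (T.vee X n)).proj.map (X := B.unop.as)
      (Y := ⟨_, hX.le_vee hQ⟩) (ObjectProperty.homMk biprod.inl)).op)
    (d' := ((T.projIdeal (T.vee X n)).proj.map (X := ⟨_, hX.le_vee hQ⟩) (Y := B.unop.as)
      (ObjectProperty.homMk biprod.fst)).op) ?_ ?_⟩
  · rw [← op_comp, ← Functor.map_comp]
    congr 2
    ext
    exact biprod.inl_desc _ _
  · rw [← op_comp, ← Functor.map_comp]
    congr 1
    rw [← sub_eq_zero, ← Functor.map_sub, HomIdeal.proj_map_eq_zero_iff]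
    intro Z ε
    change T.pull (biprod.fst ≫ f.hom - biprod.desc f.hom p) ε = 0
    have e : biprod.fst ≫ f.hom - biprod.desc f.hom p = biprod.snd ≫ (-p) := by
      ext <;> simp
    rw [e, T.pull_comp, hPP.ext_eq_zero (T.pull (-p) ε), T.pull_zero]

/-- A presentation by a morphism `f : X₁ ⟶ X₀` is, in the costable category, one by an inflation
`X₁ ⟶ X₀ ⊞ I` with `I` injective; the cokernel of the inflation is the required object. -/
lemma exists_iso_functorG (G : T.Costable X n ⥤ AddCommGrpCat.{v}) (hG : T.catL X n G) :
    ∃ M : C, Nonempty ((T.functorG X n).obj (op M) ≅ G) := by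
  rw [catL_eq] at hG
  obtain ⟨hadd, A, B, g, s, hB, h⟩ := hG
  obtain ⟨f, rfl⟩ := (T.injIdeal (T.wedge X n)).proj.map_surjective (X := A.as) (Y := B.as) g
  obtain ⟨J, K, j, k, hJ, hj⟩ := hI A.as.obj
  obtain ⟨M, l, δ, hδ⟩ := conflation_lift f.hom hj
  have hQ : X (B.as.obj ⊞ J) := hX.closedUnderSums.biprod _ _ hB (hX.of_inj hP hJ)
  refine ⟨M, (hX.isPresentation_functorG hP hδ hQ A.as.property).nonempty_iso h
    (d := (T.injIdeal (T.wedge X n)).proj.map (X := ⟨_, hX.le_wedge hP hQ⟩)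
      (Y := B.as) (ObjectProperty.homMk biprod.fst))
    (d' := (T.injIdeal (T.wedge X n)).proj.map (X := B.as) (Y := ⟨_, hX.le_wedge hP hQ⟩)
      (ObjectProperty.homMk biprod.inl)) ?_ ?_⟩
  · rw [← Functor.map_comp]
    congr 1
    ext
    exact biprod.lift_fst _ _
  · rw [← Functor.map_comp]
    rw [← sub_eq_zero, ← Functor.map_sub, HomIdeal.proj_map_eq_zero_iff]
    intro Z ε
    change T.push (f.hom ≫ biprod.inl - biprod.lift f.hom j) ε = 0
    have e : f.hom ≫ biprod.inl - biprod.lift f.hom j = (-j) ≫ biprod.inr := by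
      ext <;> simp
    rw [e, T.push_comp, hJ.ext_eq_zero (T.push (-j) ε), T.push_zero]

end

/-! ### Weak idempotent completeness of the quotient -/

/-- A split epimorphism of `C / [X]` is, up to isomorphism, the image of a split deflation
`(M ⊞ X₀) ⊞ P ⟶ N` of `C`, and that has a kernel. -/
lemma weaklyIdempotentComplete_quot (hX : T.IsClusterTilting hI n X) (hP : T.EnoughEProj) :
    WeaklyIdempotentComplete hX.ideal.Quot := by
  intro M N f hf
  obtain ⟨M, rfl⟩ : ∃ M', hX.ideal.proj.obj M' = M := ⟨M.as, rfl⟩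
  obtain ⟨N, rfl⟩ : ∃ N', hX.ideal.proj.obj N' = N := ⟨N.as, rfl⟩
  obtain ⟨⟨s, hs⟩⟩ := hf
  obtain ⟨f, rfl⟩ := hX.ideal.proj.map_surjective f
  obtain ⟨s, rfl⟩ := hX.ideal.proj.map_surjective s
  rw [← Functor.map_comp, ← hX.ideal.proj.map_id, ← sub_eq_zero, ← Functor.map_sub,
    HomIdeal.proj_map_eq_zero_iff] at hs
  obtain ⟨X₀, hX₀, a, b, hab⟩ := hs
  obtain ⟨K, P, k, p, hPP, hp⟩ := hP N
  obtain ⟨L, l, δ, hδ⟩ := conflation_desc (biprod.desc f b) hp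
  -- the deflation is split by `(s, -a, 0)`, so that its extension is zero
  have hsplit : biprod.lift (biprod.lift s (-a)) 0 ≫ biprod.desc (biprod.desc f b) p = 𝟙 N := by
    simp [hab]
  have hδ0 : δ = 0 := by
    rw [← T.pull_id δ]
    exact (pull_eq_zero_iff hδ _).2 ⟨_, hsplit⟩
  subst hδ0
  obtain ⟨e, -, he⟩ := exists_iso_of_realizes_zero hδ
  have hsp : (ShortComplex.mk (biprod.inl : L ⟶ L ⊞ N) biprod.snd (by simp)).Splitting :=
    ShortComplex.Splitting.ofHasBinaryBiproduct L N
  have hzero : HasZeroObject hX.ideal.Quot := by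
    obtain ⟨Z, hZ⟩ := HasZeroObject.zero (C := C)
    exact ⟨⟨_, hX.ideal.proj.map_isZero hZ⟩⟩
  have hker : HasKernel (hX.ideal.proj.map (biprod.snd : L ⊞ N ⟶ N)) :=
    ⟨⟨_, (hsp.map hX.ideal.proj).fIsKernel⟩⟩
  have hQ : X (X₀ ⊞ P) := hX.closedUnderSums.biprod _ _ hX₀ (hX.of_proj hPP)
  -- adding an object of `X` does not change an object of the quotient
  let q : hX.ideal.proj.obj ((M ⊞ X₀) ⊞ P) ≅ hX.ideal.proj.obj M :=
    { hom := hX.ideal.proj.map (biprod.fst ≫ biprod.fst)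
      inv := hX.ideal.proj.map (biprod.inl ≫ biprod.inl)
      hom_inv_id := by
        rw [← Functor.map_comp, ← hX.ideal.proj.map_id, ← sub_eq_zero, ← Functor.map_sub,
          HomIdeal.proj_map_eq_zero_iff]
        refine ⟨X₀ ⊞ P, hQ, biprod.lift (biprod.fst ≫ biprod.snd) biprod.snd,
          -biprod.desc (biprod.inr ≫ biprod.inl) biprod.inr, ?_⟩
        ext <;> simp
      inv_hom_id := by
        rw [← Functor.map_comp, ← hX.ideal.proj.map_id]
        simp }
  have hf : hX.ideal.proj.map f = (q.symm ≪≫ (hX.ideal.proj.mapIso e).symm).hom ≫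
      hX.ideal.proj.map biprod.snd := by
    change _ = (hX.ideal.proj.map _ ≫ hX.ideal.proj.map e.inv) ≫ _
    rw [← Functor.map_comp, ← Functor.map_comp, ← he]
    simp
  rw [hf]
  infer_instance

end IsClusterTilting

end Extriangulation

namespace Extriangulation

variable {C : Type u} [Category.{v} C] [Preadditive C] [HasZeroObject C] [HasBinaryBiproducts C]
  {T : Extriangulation C} {X : ObjectProperty C} {n : ℕ}

/-! ### The induced functors on the quotient -/

section Quotient

variable {I : HomIdeal C}

lemma additive_functorF
    (h : ∀ ⦃M N : C⦄ (f : M ⟶ N), f ∈ I.carrier M N → (T.functorH X n).map f = 0) :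
    (T.functorF I h).Additive where
  map_add {M N f g} := by
    obtain ⟨f, rfl⟩ := I.proj.map_surjective (X := M.as) (Y := N.as) f
    obtain ⟨g, rfl⟩ := I.proj.map_surjective (X := M.as) (Y := N.as) g
    exact (T.functorH X n).map_add

lemma additive_functorK
    (h : ∀ ⦃M N : C⦄ (f : M ⟶ N), f ∈ I.carrier M N → (T.functorG X n).map f.op = 0) :
    (T.functorK I h).Additive where
  map_add {M N f g} := by
    obtain ⟨f, rfl⟩ : ∃ k, Quiver.Hom.op k = f := ⟨f.unop, rfl⟩
    obtain ⟨g, rfl⟩ : ∃ k, Quiver.Hom.op k = g := ⟨g.unop, rfl⟩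
    obtain ⟨f, rfl⟩ := I.proj.map_surjective (X := N.unop.as) (Y := M.unop.as) f
    obtain ⟨g, rfl⟩ := I.proj.map_surjective (X := N.unop.as) (Y := M.unop.as) g
    exact (T.functorG X n).map_add (f := f.op) (g := g.op)

lemma faithful_functorF
    (h : ∀ ⦃M N : C⦄ (f : M ⟶ N), f ∈ I.carrier M N ↔ (T.functorH X n).map f = 0) :
    (T.functorF I fun _ _ f => (h f).1).Faithful where
  map_injective {M N f g} hfg := by
    obtain ⟨f, rfl⟩ := I.proj.map_surjective (X := M.as) (Y := N.as) f
    obtain ⟨g, rfl⟩ := I.proj.map_surjective (X := M.as) (Y := N.as) g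
    rw [← sub_eq_zero, ← Functor.map_sub, I.proj_map_eq_zero_iff, h, Functor.map_sub, sub_eq_zero]
    exact hfg

lemma faithful_functorK
    (h : ∀ ⦃M N : C⦄ (f : M ⟶ N), f ∈ I.carrier M N ↔ (T.functorG X n).map f.op = 0) :
    (T.functorK I fun _ _ f => (h f).1).Faithful where
  map_injective {M N f g} hfg := by
    obtain ⟨f, rfl⟩ : ∃ k, Quiver.Hom.op k = f := ⟨f.unop, rfl⟩
    obtain ⟨g, rfl⟩ : ∃ k, Quiver.Hom.op k = g := ⟨g.unop, rfl⟩
    obtain ⟨f, rfl⟩ := I.proj.map_surjective (X := N.unop.as) (Y := M.unop.as) f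
    obtain ⟨g, rfl⟩ := I.proj.map_surjective (X := N.unop.as) (Y := M.unop.as) g
    congr 1
    rw [← sub_eq_zero, ← Functor.map_sub, I.proj_map_eq_zero_iff, h, op_sub, Functor.map_sub,
      sub_eq_zero]
    exact hfg

variable {hI : T.EnoughEInj} (hX : T.IsClusterTilting hI n X)
include hX

lemma IsClusterTilting.full_functorF
    (h : ∀ ⦃M N : C⦄ (f : M ⟶ N), f ∈ I.carrier M N → (T.functorH X n).map f = 0) :
    (T.functorF I h).Full where
  map_surjective {M N} φ := by
    obtain ⟨X₀, L, x, y, ⟨δ, hδ⟩, hX₀, hL⟩ := hX.exists_conflation_left M.as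
    have hL' := (hX.vee_iff L).2 hL
    obtain ⟨f, hf⟩ := (hX.isVersal_functorH hδ hX₀ hL').map_surjective
      (hX.isPresentation_functorH hδ hX₀ hL') (N := N.as) φ
    exact ⟨I.proj.map f, hf⟩

lemma IsClusterTilting.full_functorK (hP : T.EnoughEProj)
    (h : ∀ ⦃M N : C⦄ (f : M ⟶ N), f ∈ I.carrier M N → (T.functorG X n).map f.op = 0) :
    (T.functorK I h).Full where
  map_surjective {M N} φ := by
    obtain ⟨L, X₀, x, y, ⟨δ, hδ⟩, hX₀, hL⟩ := hX.exists_conflation_right M.unop.as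
    have hL' := (hX.wedge_iff hP L).2 hL
    obtain ⟨f, hf⟩ := (hX.isVersal_functorG hP hδ hX₀ hL').map_surjective
      (hX.isPresentation_functorG hP hδ hX₀ hL') (N := op N.unop.as) φ
    exact ⟨(I.proj.map f.unop).op, hf⟩

lemma IsClusterTilting.catR_functorH (M : C) : T.catR X n ((T.functorH X n).obj M) := by
  rw [catR_eq]
  obtain ⟨X₀, L, x, y, ⟨δ, hδ⟩, hX₀, hL⟩ := hX.exists_conflation_left M
  exact ⟨inferInstance, _, _, _, _, by exact hX₀,
    hX.isPresentation_functorH hδ hX₀ ((hX.vee_iff L).2 hL)⟩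

lemma IsClusterTilting.catL_functorG (hP : T.EnoughEProj) (M : C) :
    T.catL X n ((T.functorG X n).obj (op M)) := by
  rw [catL_eq]
  obtain ⟨L, X₀, x, y, ⟨δ, hδ⟩, hX₀, hL⟩ := hX.exists_conflation_right M
  exact ⟨inferInstance, _, _, _, _, by exact hX₀,
    hX.isPresentation_functorG hP hδ hX₀ ((hX.wedge_iff hP L).2 hL)⟩

end Quotient

end Extriangulation

end ClusterQuotient

open ClusterQuotient in
theorem mainTheorem6 {C : Type u} [Category.{v} C] [Preadditive C] [HasZeroObject C]
    [HasBinaryBiproducts C] (T : Extriangulation C) (hP : T.EnoughEProj) (hI : T.EnoughEInj)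
    (n : ℕ) (X : ObjectProperty C) (hX : T.IsClusterTilting hI n X) :
    -- `X_{n+1}^∨ = C = X_{n+1}^∧`
    T.vee X (n + 1) = ⊤ ∧ T.wedge X (n + 1) = ⊤ ∧
    -- `[X]` is the kernel of `M ↦ 𝔼(-, M)` and of `M ↦ 𝔼(M, -)`, so `F` and `K` live on `C / [X]`
    ∃ (hF : ∀ ⦃M N : C⦄ (f : M ⟶ N),
          f ∈ hX.ideal.carrier M N ↔ (T.functorH X n).map f = 0)
      (hK : ∀ ⦃M N : C⦄ (f : M ⟶ N),
          f ∈ hX.ideal.carrier M N ↔ (T.functorG X n).map f.op = 0),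
      let F := T.functorF hX.ideal (fun _ _ f => (hF f).1)
      let K := T.functorK hX.ideal (fun _ _ f => (hK f).1)
      -- two weakly idempotent complete exact structures on `C / [X]`, and the Krull-Schmidt property
      IsExactCategory (inducedClass F) ∧
      IsExactCategory (inducedClassOp K) ∧
      WeaklyIdempotentComplete hX.ideal.Quot ∧
      (KrullSchmidt C → KrullSchmidt hX.ideal.Quot) ∧
      -- `F` is an equivalence onto `R` and `K` a duality onto `L`, of exact categories
      IsExactCategory (inducedClass (T.catR X n).ι) ∧
      IsExactCategory (inducedClass (T.catL X n).ι) ∧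
      (∃ hR : ∀ M, T.catR X n (F.obj M),
        IsExactEquivalence ((T.catR X n).lift F hR)
          (inducedClass F) (inducedClass (T.catR X n).ι)) ∧
      (∃ hL : ∀ M, T.catL X n (K.obj M),
        IsExactDuality ((T.catL X n).lift K hL)
          (inducedClassOp K) (inducedClass (T.catL X n).ι)) ∧
      Nonempty ((T.catR X n).FullSubcategoryᵒᵖ ≌ (T.catL X n).FullSubcategory) := by
  have hF : ∀ ⦃M N : C⦄ (f : M ⟶ N), f ∈ hX.ideal.carrier M N ↔ (T.functorH X n).map f = 0 :=
    fun _ _ f => hX.mem_ideal_iff_functorH f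
  have hK : ∀ ⦃M N : C⦄ (f : M ⟶ N), f ∈ hX.ideal.carrier M N ↔ (T.functorG X n).map f.op = 0 :=
    fun _ _ f => hX.mem_ideal_iff_functorG hP f
  refine ⟨hX.vee_succ_eq_top, hX.wedge_succ_eq_top hP, hF, hK, ?_⟩
  intro F K
  have : F.Additive := Extriangulation.additive_functorF _
  have : F.Full := hX.full_functorF _
  have : F.Faithful := Extriangulation.faithful_functorF hF
  have : K.Additive := Extriangulation.additive_functorK _
  have : K.Full := hX.full_functorK hP _
  have : K.Faithful := Extriangulation.faithful_functorK hK
  have hR : ∀ M, T.catR X n (F.obj M) := fun M => hX.catR_functorH M.as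
  have hL : ∀ M, T.catL X n (K.obj M) := fun M => hX.catL_functorG hP M.unop.as
  have hRsurj : ∀ G, T.catR X n G → ∃ M, Nonempty (F.obj M ≅ G) := fun G hG =>
    let ⟨M, e⟩ := hX.exists_iso_functorH hP G hG
    ⟨hX.ideal.proj.obj M, e⟩
  have hLsurj : ∀ G, T.catL X n G → ∃ M, Nonempty (K.obj M ≅ G) := fun G hG =>
    let ⟨M, e⟩ := hX.exists_iso_functorG hP G hG
    ⟨op (hX.ideal.proj.obj M), e⟩
  have hRiso : ∀ G G', (G ≅ G') → T.catR X n G → T.catR X n G' := by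
    rw [Extriangulation.catR_eq]
    exact fun _ _ => FinPresented.of_iso
  have hLiso : ∀ G G', (G ≅ G') → T.catL X n G → T.catL X n G' := by
    rw [Extriangulation.catL_eq]
    exact fun _ _ => FinPresented.of_iso
  have hRext := hX.isClosedUnderExtensions_catR
  have hLext := hX.isClosedUnderExtensions_catL hP
  have : F.essImage.IsClosedUnderExtensions := by rwa [essImage_eq F hR hRiso hRsurj]
  have : K.essImage.IsClosedUnderExtensions := by rwa [essImage_eq K hL hLiso hLsurj]
  have : (T.catR X n).ι.essImage.IsClosedUnderExtensions := by
    rwa [essImage_eq (T.catR X n).ι (fun G => G.property) hRiso fun G hG => ⟨⟨G, hG⟩, ⟨Iso.refl _⟩⟩]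
  have : (T.catL X n).ι.essImage.IsClosedUnderExtensions := by
    rwa [essImage_eq (T.catL X n).ι (fun G => G.property) hLiso fun G hG => ⟨⟨G, hG⟩, ⟨Iso.refl _⟩⟩]
  obtain ⟨Z, hZ⟩ := HasZeroObject.zero (C := C)
  have hZD := hX.ideal.proj.map_isZero hZ
  have hRequiv : ((T.catR X n).lift F hR).IsEquivalence := isEquivalence_lift F hR hRsurj
  have hLequiv : ((T.catL X n).lift K hL).IsEquivalence := isEquivalence_lift K hL hLsurj
  have hZR : IsZero (((T.catR X n).lift F hR).obj (hX.ideal.proj.obj Z)) :=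
    Functor.map_isZero _ hZD
  have hZL : IsZero (((T.catL X n).lift K hL).obj (op (hX.ideal.proj.obj Z))) :=
    Functor.map_isZero _ hZD.op
  exact ⟨isExactCategory_inducedClass F hZD, isExactCategory_inducedClassOp K hZD,
    hX.weaklyIdempotentComplete_quot hP, fun h => h.quot _,
    isExactCategory_inducedClass _ hZR, isExactCategory_inducedClass _ hZL,
    ⟨hR, hRequiv, fun _ _ _ _ _ => Iff.rfl⟩, ⟨hL, hLequiv, fun _ _ _ _ _ => Iff.rfl⟩,
    ⟨((T.catR X n).lift F hR).asEquivalence.symm.op.trans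
      ((T.catL X n).lift K hL).asEquivalence⟩⟩
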